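/- A multi-objective graph consists of a finite set of nodes $V$ and a finite set $E \subseteq V\times V$ of directed edges, each edge $e$ carrying $W \ge 1$ non-negative objective values $w_e[1],\dots,w_e[W]$. Given such a graph in adjacency-list form, a start node $s \in V$ and $K \ge 1$ coefficient vectors $\lambda_1,\dots,\lambda_K$ of $W$ positive real numbers each, the Standard Algorithm does the following for each $i=1,\dots,K$: it computes for every edge $e$ the cost $\mathrm{Cost}(e,\lambda_i)=\sum_{j=1}^{W}\lambda_i[j]\,w_e[j]$, runs Dijkstra's algorithm from $s$ with these costs as edge lengths, using a Fibonacci heap as the priority queue, and appends the resulting tree of shortest paths (stored as one predecessor pointer per node) to the output. Lemma. The Standard Algorithm halts after $$O\bigl(K\cdot W\cdot |E| + K\cdot |V|\cdot \log |V|\bigr)$$ steps of a unit-cost random access machine with real arithmetic. That is, there is an absolute constant $C$ such that for every multi-objective graph with $|V| \ge 2$ and $W\ge 1$, every $s\in V$ and every family of $K \ge 1$ coefficient vectors, the Standard Algorithm halts after at most $C\,(K W |E| + K |V| \log |V|)$ steps. -/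

import Mathlib

set_option linter.constructorNameAsVariable false

namespace MOWSP

/-! ### Multi-objective graphs -/

/-- A multi-objective graph on the nodes `0, …, n - 1`: a set `E` of directed edges (ordered pairs
of nodes) and, for every edge, `W` non-negative objective values. -/
structure MOG (n W : ℕ) where
  E : Finset (Fin n × Fin n)
  w : {e // e ∈ E} → Fin W → ℝ
  w_nonneg : ∀ e j, 0 ≤ w e j

/-- A coefficient vector: `W` positive real numbers. -/
structure CoeffVector (W : ℕ) where
  coeff : Fin W → ℝ
  coeff_pos : ∀ j, 0 < coeff j

/-! ### A unit-cost random access machine with real arithmetic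

The memory consists of finitely many registers and finitely many arrays. A register or an array
cell holds either a natural number (index, pointer, counter, flag) or a real number. Programs are
terms of a small imperative language. Every constant, memory access, arithmetic operation,
comparison, logical connective, assignment and branching counts as one step. There are no other
operations; in particular there is no operation on a whole array. -/

/-- Registers that hold natural numbers. -/
inductive WVar
  | n | m | W | K | s
  | i | j | e | p | b | o
  | u | v | x | y | z | r | min
  deriving DecidableEq

/-- Registers that hold real numbers. -/
inductive RVar
  | acc | c
  deriving DecidableEq

/-- Arrays of natural numbers. -/
inductive WArr
  | off | head
  | next | prev | parent | degree | mark | bucket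
  | status | pred | out
  deriving DecidableEq

/-- Arrays of real numbers. -/
inductive RArr
  | wt | lam | cost | key
  deriving DecidableEq

/-- The contents of the memory. -/
structure State where
  word : WVar → ℕ
  real : RVar → ℝ
  warr : WArr → ℕ → ℕ
  rarr : RArr → ℕ → ℝ

/-- Expressions with values in the natural numbers. -/
inductive WExpr
  | lit (k : ℕ)
  | var (x : WVar)
  | get (a : WArr) (i : WExpr)
  | add (e f : WExpr)
  | sub (e f : WExpr)

/-- Expressions with real values. -/
inductive RExpr
  | zero
  | var (x : RVar)
  | get (a : RArr) (i : WExpr)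
  | add (e f : RExpr)
  | mul (e f : RExpr)

/-- Tests. -/
inductive Test
  | eq (e f : WExpr)
  | lt (e f : WExpr)
  | rlt (e f : RExpr)
  | not (t : Test)
  | and (t t' : Test)

/-- Programs. -/
inductive Prog
  | skip
  | setW (x : WVar) (e : WExpr)
  | setR (x : RVar) (e : RExpr)
  | putW (a : WArr) (i : WExpr) (e : WExpr)
  | putR (a : RArr) (i : WExpr) (e : RExpr)
  | seq (p q : Prog)
  | ite (t : Test) (p q : Prog)
  | loop (t : Test) (p : Prog)

def WExpr.eval (σ : State) : WExpr → ℕ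
  | .lit k => k
  | .var x => σ.word x
  | .get a i => σ.warr a (i.eval σ)
  | .add e f => e.eval σ + f.eval σ
  | .sub e f => e.eval σ - f.eval σ

def RExpr.eval (σ : State) : RExpr → ℝ
  | .zero => 0
  | .var x => σ.real x
  | .get a i => σ.rarr a (i.eval σ)
  | .add e f => e.eval σ + f.eval σ
  | .mul e f => e.eval σ * f.eval σ

def Test.Holds (σ : State) : Test → Prop
  | .eq e f => e.eval σ = f.eval σ
  | .lt e f => e.eval σ < f.eval σ
  | .rlt e f => e.eval σ < f.eval σ
  | .not t => ¬ t.Holds σ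
  | .and t t' => t.Holds σ ∧ t'.Holds σ

/-- The number of steps that the evaluation of an expression takes. -/
def WExpr.steps : WExpr → ℕ
  | .lit _ => 1
  | .var _ => 1
  | .get _ i => i.steps + 1
  | .add e f => e.steps + f.steps + 1
  | .sub e f => e.steps + f.steps + 1

/-- The number of steps that the evaluation of an expression takes. -/
def RExpr.steps : RExpr → ℕ
  | .zero => 1
  | .var _ => 1
  | .get _ i => i.steps + 1
  | .add e f => e.steps + f.steps + 1
  | .mul e f => e.steps + f.steps + 1

/-- The number of steps that the evaluation of a test takes. -/
def Test.steps : Test → ℕ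
  | .eq e f => e.steps + f.steps + 1
  | .lt e f => e.steps + f.steps + 1
  | .rlt e f => e.steps + f.steps + 1
  | .not t => t.steps + 1
  | .and t t' => t.steps + t'.steps + 1

def State.setW (σ : State) (x : WVar) (k : ℕ) : State :=
  { σ with word := Function.update σ.word x k }

def State.setR (σ : State) (x : RVar) (c : ℝ) : State :=
  { σ with real := Function.update σ.real x c }

def State.putW (σ : State) (a : WArr) (i k : ℕ) : State :=
  { σ with warr := Function.update σ.warr a (Function.update (σ.warr a) i k) }

def State.putR (σ : State) (a : RArr) (i : ℕ) (c : ℝ) : State :=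
  { σ with rarr := Function.update σ.rarr a (Function.update (σ.rarr a) i c) }

/-- `Exec p σ σ' t`: the program `p`, started in the memory `σ`, halts in the memory `σ'` after
exactly `t` steps. -/
inductive Exec : Prog → State → State → ℕ → Prop
  | skip (σ) : Exec .skip σ σ 0
  | setW (x e σ) : Exec (.setW x e) σ (σ.setW x (e.eval σ)) (e.steps + 1)
  | setR (x e σ) : Exec (.setR x e) σ (σ.setR x (e.eval σ)) (e.steps + 1)
  | putW (a i e σ) :
      Exec (.putW a i e) σ (σ.putW a (i.eval σ) (e.eval σ)) (i.steps + e.steps + 1)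
  | putR (a i e σ) :
      Exec (.putR a i e) σ (σ.putR a (i.eval σ) (e.eval σ)) (i.steps + e.steps + 1)
  | seq {p q σ σ' σ'' t t'} : Exec p σ σ' t → Exec q σ' σ'' t' →
      Exec (.seq p q) σ σ'' (t + t')
  | ite_true {b p q σ σ' t} : b.Holds σ → Exec p σ σ' t →
      Exec (.ite b p q) σ σ' (b.steps + 1 + t)
  | ite_false {b p q σ σ' t} : ¬ b.Holds σ → Exec q σ σ' t →
      Exec (.ite b p q) σ σ' (b.steps + 1 + t)
  | loop_stop {b p σ} : ¬ b.Holds σ → Exec (.loop b p) σ σ (b.steps + 1)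
  | loop_step {b p σ σ' σ'' t t'} : b.Holds σ → Exec p σ σ' t →
      Exec (.loop b p) σ' σ'' t' → Exec (.loop b p) σ σ'' (b.steps + 1 + t + t')

/-- The machine is deterministic: a halting run determines its result and its running time. -/
theorem Exec.unique {p : Prog} {σ σ₁ σ₂ : State} {t₁ t₂ : ℕ}
    (h₁ : Exec p σ σ₁ t₁) (h₂ : Exec p σ σ₂ t₂) : σ₁ = σ₂ ∧ t₁ = t₂ := by
  induction h₁ generalizing σ₂ t₂ with
  | skip | setW | setR | putW | putR => cases h₂; exact ⟨rfl, rfl⟩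
  | seq _ _ ih ih' =>
    cases h₂ with
    | seq a b =>
      obtain ⟨rfl, rfl⟩ := ih a
      obtain ⟨rfl, rfl⟩ := ih' b
      exact ⟨rfl, rfl⟩
  | ite_true hb _ ih =>
    cases h₂ with
    | ite_true _ a => obtain ⟨rfl, rfl⟩ := ih a; exact ⟨rfl, rfl⟩
    | ite_false hn _ => exact absurd hb hn
  | ite_false hb _ ih =>
    cases h₂ with
    | ite_true hn _ => exact absurd hn hb
    | ite_false _ a => obtain ⟨rfl, rfl⟩ := ih a; exact ⟨rfl, rfl⟩
  | loop_stop hb =>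
    cases h₂ with
    | loop_stop _ => exact ⟨rfl, rfl⟩
    | loop_step hn _ _ => exact absurd hn hb
  | loop_step hb _ _ ih ih' =>
    cases h₂ with
    | loop_stop hn => exact absurd hb hn
    | loop_step _ a c =>
      obtain ⟨rfl, rfl⟩ := ih a
      obtain ⟨rfl, rfl⟩ := ih' c
      exact ⟨rfl, rfl⟩

/-! ### Abbreviations for writing programs -/

/-- Sequential execution of a list of programs. -/
def block : List Prog → Prog
  | [] => .skip
  | p :: ps => .seq p (block ps)

instance : Coe WVar WExpr := ⟨.var⟩
instance : Add WExpr := ⟨.add⟩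
instance : Sub WExpr := ⟨.sub⟩
instance : Add RExpr := ⟨.add⟩
instance : Mul RExpr := ⟨.mul⟩

/-! The registers as expressions. -/

abbrev WExpr.n : WExpr := .var .n
abbrev WExpr.W : WExpr := .var .W
abbrev WExpr.s : WExpr := .var .s
abbrev WExpr.e : WExpr := .var .e
abbrev WExpr.p : WExpr := .var .p
abbrev WExpr.b : WExpr := .var .b
abbrev WExpr.o : WExpr := .var .o
abbrev WExpr.j : WExpr := .var .j
abbrev WExpr.u : WExpr := .var .u
abbrev WExpr.v : WExpr := .var .v
abbrev WExpr.x : WExpr := .var .x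
abbrev WExpr.y : WExpr := .var .y
abbrev WExpr.z : WExpr := .var .z
abbrev WExpr.r : WExpr := .var .r
abbrev WExpr.min : WExpr := .var .min
abbrev RExpr.acc : RExpr := .var .acc
abbrev RExpr.c : RExpr := .var .c

/-- Reading a cell of an array of natural numbers. -/
def WArr.at (a : WArr) (i : WExpr) : WExpr := .get a i

/-- Reading a cell of an array of real numbers. -/
def RArr.at (a : RArr) (i : WExpr) : RExpr := .get a i

/-- `x := x + 1`. -/
def incr (x : WVar) : Prog := .setW x (x + .lit 1)

/-- `for x = 0 to bound - 1 do body`. -/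
def forUpTo (x bound : WVar) (body : Prog) : Prog :=
  block [.setW x (.lit 0), .loop (.lt x bound) (block [body, incr x])]

/-! ### The Fibonacci heap

The items of the heap are nodes `0, …, n - 1`, and `key` holds their keys. The number `n` serves as
the null pointer. The roots, and the children of each item `x`, form circular doubly linked lists
(`next`, `prev`) with sentinels: the sentinel of the list of roots is the cell `n`, the sentinel of
the list of the children of `x` is the cell `n + 1 + x`. The arrays `parent`, `degree`, `mark` and
the register `min` are the usual fields of a Fibonacci heap. The array `bucket`, indexed by degrees,
is used by the consolidation and is all null outside of it. -/

/-- The null pointer, which is also the sentinel of the list of roots. -/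
def null : WExpr := .var .n

/-- The sentinel of the list of the children of `x`. -/
def sentinel (x : WVar) : WExpr := null + .lit 1 + x

/-- Insert the cell `x` behind the cell `h` of a doubly linked list. -/
def listInsert (h : WExpr) (x : WVar) : Prog := block [
  .putW .next x (WArr.next.at h),
  .putW .prev x h,
  .putW .prev (WArr.next.at h) x,
  .putW .next h x]

/-- Remove the cell `x` from its doubly linked list. -/
def listRemove (x : WVar) : Prog := block [
  .putW .next (WArr.prev.at x) (WArr.next.at x),
  .putW .prev (WArr.next.at x) (WArr.prev.at x)]

/-- `min := x` if there is no minimum yet, or if the key of `x` is smaller. -/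
def updateMin (x : WVar) : Prog :=
  .ite (.eq .min null) (.setW .min x)
    (.ite (.rlt (RArr.key.at x) (RArr.key.at .min)) (.setW .min x) .skip)

/-- Make an empty heap. -/
def heapInit : Prog := block [
  forUpTo .v .n (.putW .bucket .v null),
  .putW .next null null,
  .putW .prev null null,
  .setW .min null]

/-- Insert the item `v`, whose key is already stored, as a root without children. -/
def heapInsert : Prog := block [
  .putW .next (sentinel .v) (sentinel .v),
  .putW .prev (sentinel .v) (sentinel .v),
  .putW .parent .v null,
  .putW .degree .v (.lit 0),
  .putW .mark .v (.lit 0),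
  listInsert null .v,
  updateMin .v]

/-- Cut the item `x` from its parent `y` and make it an unmarked root. -/
def heapCut : Prog := block [
  listRemove .x,
  .putW .degree .y (WArr.degree.at .y - .lit 1),
  listInsert null .x,
  .putW .parent .x null,
  .putW .mark .x (.lit 0)]

/-- The cascading cut at `y`, which has just lost a child: as long as `y` is a marked non-root, cut
it and move on to its former parent; finally mark `y` unless it is a root. -/
def heapCascadingCut : Prog := block [
  .loop (.and (.not (.eq (WArr.parent.at .y) null)) (.eq (WArr.mark.at .y) (.lit 1)))
    (block [
      .setW .x .y,
      .setW .y (WArr.parent.at .x),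
      heapCut]),
  .ite (.eq (WArr.parent.at .y) null) .skip (.putW .mark .y (.lit 1))]

/-- Decrease the key of the item `v` of the heap to `c`. -/
def heapDecreaseKey : Prog := block [
  .putR .key .v .c,
  .setW .y (WArr.parent.at .v),
  .ite (.eq .y null) .skip
    (.ite (.rlt (RArr.key.at .v) (RArr.key.at .y))
      (block [.setW .x .v, heapCut, heapCascadingCut])
      .skip),
  .ite (.eq (WArr.parent.at .v) null) (updateMin .v) .skip]

/-- Make the root `y` a child of the root `x`. -/
def heapLink : Prog := block [
  listRemove .y,
  listInsert (sentinel .x) .y,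
  .putW .parent .y .x,
  .putW .mark .y (.lit 0),
  .putW .degree .x (WArr.degree.at .x + .lit 1)]

/-- Go through the roots and link roots of equal degree until the degrees of the roots are pairwise
different. Then go through the remaining roots, clear the buckets that they occupy, and determine
the minimum. -/
def heapConsolidate : Prog := block [
  .setW .r (WArr.next.at null),
  .loop (.not (.eq .r null)) (block [
    .setW .x .r,
    .setW .r (WArr.next.at .r),
    .loop (.not (.eq (WArr.bucket.at (WArr.degree.at .x)) null)) (block [
      .setW .y (WArr.bucket.at (WArr.degree.at .x)),
      .putW .bucket (WArr.degree.at .x) null,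
      .ite (.rlt (RArr.key.at .y) (RArr.key.at .x))
        (block [.setW .z .x, .setW .x .y, .setW .y .z])
        .skip,
      heapLink]),
    .putW .bucket (WArr.degree.at .x) .x]),
  .setW .min null,
  .setW .r (WArr.next.at null),
  .loop (.not (.eq .r null)) (block [
    .putW .bucket (WArr.degree.at .r) null,
    updateMin .r,
    .setW .r (WArr.next.at .r)])]

/-- Remove an item with minimal key from the non-empty heap and store it in `u`: its children
become roots, it leaves the list of roots, and the heap is consolidated. -/
def heapExtractMin : Prog := block [
  .setW .u .min,
  .loop (.not (.eq (WArr.next.at (sentinel .u)) (sentinel .u))) (block [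
    .setW .x (WArr.next.at (sentinel .u)),
    listRemove .x,
    listInsert null .x,
    .putW .parent .x null]),
  listRemove .u,
  heapConsolidate]

/-! ### The Standard Algorithm

The input graph is stored in adjacency form: the edges are numbered `0, …, m - 1`, the edges that
leave the node `u` have the numbers `off[u], …, off[u+1] - 1`, and `head[e]` is the node that the
edge `e` enters. The objective values and the coefficient vectors are stored row by row. -/

/-- For every edge `e`, compute `cost[e] = ∑ j, λ_i[j] * w_e[j]`; the register `b` points to the
beginning of `λ_i`. -/
def computeCosts : Prog := block [
  .setW .p (.lit 0),
  forUpTo .e .m (block [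
    .setR .acc .zero,
    forUpTo .j .W (block [
      .setR .acc (.acc + RArr.lam.at (.b + .j) * RArr.wt.at .p),
      incr .p]),
    .putR .cost .e .acc])]

/-- Dijkstra's algorithm from the node `s` with the edge lengths `cost`. A node has `status` 0 before
it is reached, 1 while it is in the heap, and 2 after it was extracted. When the algorithm halts,
`pred` is the tree of the shortest paths that were found: the path to `v` is obtained by following
`pred` from `v` back to `s`; `pred[s] = s`, and `pred[v]` is null if `v` was not reached. -/
def dijkstra : Prog := block [
  forUpTo .v .n (block [.putW .status .v (.lit 0), .putW .pred .v null]),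
  heapInit,
  .setW .v .s,
  .putW .status .v (.lit 1),
  .putW .pred .v .s,
  .putR .key .v .zero,
  heapInsert,
  .loop (.not (.eq .min null)) (block [
    heapExtractMin,
    .putW .status .u (.lit 2),
    .setW .e (WArr.off.at .u),
    .loop (.lt .e (WArr.off.at (.u + .lit 1))) (block [
      .setW .v (WArr.head.at .e),
      .setR .c (RArr.key.at .u + RArr.cost.at .e),
      .ite (.eq (WArr.status.at .v) (.lit 0))
        (block [
          .putW .status .v (.lit 1),
          .putW .pred .v .u,
          .putR .key .v .c,
          heapInsert])
        (.ite (.and (.eq (WArr.status.at .v) (.lit 1)) (.rlt .c (RArr.key.at .v)))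
          (block [.putW .pred .v .u, heapDecreaseKey])
          .skip),
      incr .e])])]

/-- The Standard Algorithm: for each of the `K` coefficient vectors `λ_i`, compute the costs of the
edges, run Dijkstra's algorithm, and append the resulting tree of paths to the output. -/
def standardAlgorithm : Prog := block [
  .setW .b (.lit 0),
  .setW .o (.lit 0),
  forUpTo .i .K (block [
    computeCosts,
    dijkstra,
    forUpTo .v .n (block [.putW .out .o (WArr.pred.at .v), incr .o]),
    .setW .b (.b + .W)])]

/-- The memory `σ` contains the instance `(G, s, Λ)`. Nothing is required of the rest of `σ`. -/
structure Loaded {n W K : ℕ} (G : MOG n W) (s : Fin n) (Λ : Fin K → CoeffVector W)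
    (σ : State) : Prop where
  n_eq : σ.word .n = n
  m_eq : σ.word .m = G.E.card
  W_eq : σ.word .W = W
  K_eq : σ.word .K = K
  s_eq : σ.word .s = s
  off_eq : ∀ v ≤ n, σ.warr .off v = (G.E.filter fun e => (e.1 : ℕ) < v).card
  edges : ∃ edge : Fin G.E.card ≃ {e // e ∈ G.E}, ∀ k,
    σ.warr .off (edge k).1.1 ≤ k ∧ (k : ℕ) < σ.warr .off ((edge k).1.1 + 1) ∧
    σ.warr .head k = (edge k).1.2 ∧
    ∀ j : Fin W, σ.rarr .wt (k * W + j) = G.w (edge k) j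
  lam_eq : ∀ (i : Fin K) (j : Fin W), σ.rarr .lam (i * W + j) = (Λ i).coeff j

end MOWSP

namespace MOWSP
open Function

/-! The proof is the amortized analysis of Fibonacci heaps, carried out on the pointer program
itself. Insertion and decrease-key cost O(1) and extraction costs O(log n), each measured as steps
plus change of the potential `pot`, which is 300 per root and 500 per marked non-root. A run of
Dijkstra's algorithm extracts every node at most once and scans every edge at most once, so it takes
O(m + n log n) steps. Computing the costs takes O(mW) steps, and all of this is repeated K times.

The logarithm comes from the shape of the forest. Only roots with equally many children are linked,
and a non-root that loses a second child is cut. Hence the child linked after i others still has at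
least i - 1 children. `sum_fib_roots_le` turns this into a Fibonacci bound on the root degrees, and
`HeapInv.degree_le` into 2 log n + 1. After consolidation the root degrees are pairwise different,
so O(log n) roots remain (`HeapInv.length_roots_le`).

The order of the keys plays no part in the step count. Each comparison of reals is followed into
both branches, and the minimum pointer need only be null when there are no roots and point to a root
otherwise. What must be proved is structural: the pointers form disjoint circular lists (`Lists`),
these agree with the parent fields (`Forest`), and degrees and marks satisfy the rank condition
(`HeapInv`).

Time enters through `wp_loop`, where a loop carries a budget of steps. Taking the potential as part
of the budget makes the amortization a local inequality per iteration, and the same budget proves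
termination. -/

/-! ### Weakest preconditions with running time -/

/-- The program `p` halts from `σ`, and its result and its running time satisfy `Q`. -/
def wp (p : Prog) (Q : State → ℕ → Prop) (σ : State) : Prop :=
  ∃ σ' t, Exec p σ σ' t ∧ Q σ' t

theorem wp.mono {p : Prog} {Q Q' : State → ℕ → Prop} {σ : State} (h : wp p Q σ)
    (hQ : ∀ σ' t, Q σ' t → Q' σ' t) : wp p Q' σ := by
  obtain ⟨σ', t, he, hq⟩ := h
  exact ⟨σ', t, he, hQ _ _ hq⟩

@[simp] theorem wp_skip {Q : State → ℕ → Prop} {σ : State} : wp .skip Q σ ↔ Q σ 0 := by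
  constructor
  · rintro ⟨_, _, h, hq⟩; cases h; exact hq
  · intro h; exact ⟨_, _, .skip _, h⟩

@[simp] theorem wp_setW {Q : State → ℕ → Prop} {σ : State} {x : WVar} {e : WExpr} :
    wp (.setW x e) Q σ ↔ Q (σ.setW x (e.eval σ)) (e.steps + 1) := by
  constructor
  · rintro ⟨_, _, h, hq⟩; cases h; exact hq
  · intro h; exact ⟨_, _, .setW _ _ _, h⟩

@[simp] theorem wp_setR {Q : State → ℕ → Prop} {σ : State} {x : RVar} {e : RExpr} :
    wp (.setR x e) Q σ ↔ Q (σ.setR x (e.eval σ)) (e.steps + 1) := by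
  constructor
  · rintro ⟨_, _, h, hq⟩; cases h; exact hq
  · intro h; exact ⟨_, _, .setR _ _ _, h⟩

@[simp] theorem wp_putW {Q : State → ℕ → Prop} {σ : State} {a : WArr} {i e : WExpr} :
    wp (.putW a i e) Q σ ↔ Q (σ.putW a (i.eval σ) (e.eval σ)) (i.steps + e.steps + 1) := by
  constructor
  · rintro ⟨_, _, h, hq⟩; cases h; exact hq
  · intro h; exact ⟨_, _, .putW _ _ _ _, h⟩

@[simp] theorem wp_putR {Q : State → ℕ → Prop} {σ : State} {a : RArr} {i : WExpr} {e : RExpr} :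
    wp (.putR a i e) Q σ ↔ Q (σ.putR a (i.eval σ) (e.eval σ)) (i.steps + e.steps + 1) := by
  constructor
  · rintro ⟨_, _, h, hq⟩; cases h; exact hq
  · intro h; exact ⟨_, _, .putR _ _ _ _, h⟩

@[simp] theorem wp_seq {Q : State → ℕ → Prop} {σ : State} {p q : Prog} :
    wp (.seq p q) Q σ ↔ wp p (fun σ' t => wp q (fun σ'' t' => Q σ'' (t + t')) σ') σ := by
  constructor
  · rintro ⟨_, _, h, hq⟩
    cases h with
    | seq h₁ h₂ => exact ⟨_, _, h₁, _, _, h₂, hq⟩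
  · rintro ⟨_, _, h₁, _, _, h₂, hq⟩
    exact ⟨_, _, .seq h₁ h₂, hq⟩

theorem wp_ite {Q : State → ℕ → Prop} {σ : State} {b : Test} {p q : Prog}
    (h₁ : b.Holds σ → wp p (fun σ' t => Q σ' (b.steps + 1 + t)) σ)
    (h₂ : ¬ b.Holds σ → wp q (fun σ' t => Q σ' (b.steps + 1 + t)) σ) :
    wp (.ite b p q) Q σ := by
  by_cases hb : b.Holds σ
  · obtain ⟨_, _, h, hq⟩ := h₁ hb
    exact ⟨_, _, .ite_true hb h, hq⟩
  · obtain ⟨_, _, h, hq⟩ := h₂ hb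
    exact ⟨_, _, .ite_false hb h, hq⟩

@[simp] theorem wp_block_nil {Q : State → ℕ → Prop} {σ : State} :
    wp (block []) Q σ ↔ Q σ 0 := wp_skip

@[simp] theorem wp_block_cons {Q : State → ℕ → Prop} {σ : State} {p : Prog} {ps : List Prog} :
    wp (block (p :: ps)) Q σ ↔
      wp p (fun σ' t => wp (block ps) (fun σ'' t' => Q σ'' (t + t')) σ') σ := wp_seq

/-- The rule for loops with a budget: `I σ k` says that the invariant holds and that `k` steps are
available for the remaining iterations. -/
theorem wp_loop {b : Test} {p : Prog} (I : State → ℕ → Prop)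
    (h : ∀ σ k, I σ k → b.Holds σ →
      wp p (fun σ' t => ∃ k', I σ' k' ∧ b.steps + 1 + t + k' ≤ k) σ) :
    ∀ k σ, I σ k →
      wp (.loop b p) (fun σ' t => ∃ k', I σ' k' ∧ ¬ b.Holds σ' ∧ t + k' ≤ k + b.steps + 1) σ := by
  intro k
  -- An iteration pays at least for its guard, so the budget drops strictly. The induction therefore
  -- also yields termination.
  induction k using Nat.strong_induction_on with
  | _ k ih =>
    intro σ hI
    by_cases hb : b.Holds σ
    · obtain ⟨σ₁, t₁, h₁, k₁, hI₁, hk₁⟩ := h σ k hI hb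
      obtain ⟨σ₂, t₂, h₂, k₂, hI₂, hb₂, hk₂⟩ := ih k₁ (by omega) σ₁ hI₁
      exact ⟨σ₂, _, .loop_step hb h₁ h₂, k₂, hI₂, hb₂, by omega⟩
    · exact ⟨σ, b.steps + 1, by constructor; exact hb, k, hI, hb, by omega⟩

/-! ### Registers and arrays that a program does not change -/

/-- Whether the program contains an assignment to the register `x`. -/
def Prog.modW (x : WVar) : Prog → Bool
  | .skip => false
  | .setW y _ => x = y
  | .setR _ _ => false
  | .putW _ _ _ => false
  | .putR _ _ _ => false
  | .seq p q => p.modW x || q.modW x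
  | .ite _ p q => p.modW x || q.modW x
  | .loop _ p => p.modW x

/-- Whether the program contains an assignment to a cell of the array `a`. -/
def Prog.modA (a : WArr) : Prog → Bool
  | .skip => false
  | .setW _ _ => false
  | .setR _ _ => false
  | .putW b _ _ => a = b
  | .putR _ _ _ => false
  | .seq p q => p.modA a || q.modA a
  | .ite _ p q => p.modA a || q.modA a
  | .loop _ p => p.modA a

theorem Exec.word_eq {p : Prog} {σ σ' : State} {t : ℕ} (h : Exec p σ σ' t) {x : WVar}
    (hx : p.modW x = false) : σ'.word x = σ.word x := by
  induction h <;> simp_all [Prog.modW, State.setW, State.setR, State.putW, State.putR]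

theorem Exec.warr_eq {p : Prog} {σ σ' : State} {t : ℕ} (h : Exec p σ σ' t) {a : WArr}
    (ha : p.modA a = false) : σ'.warr a = σ.warr a := by
  induction h <;> simp_all [Prog.modA, State.setW, State.setR, State.putW, State.putR]

/-- The memories `σ` and `σ'` agree on everything that `p` does not assign to. -/
structure Frame (p : Prog) (σ σ' : State) : Prop where
  word : ∀ x, p.modW x = false → σ'.word x = σ.word x
  warr : ∀ a, p.modA a = false → σ'.warr a = σ.warr a

/-- Specifications of heap operations can omit the untouched registers and arrays: the frame is
syntactic, so its side conditions reduce to `rfl`. -/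
theorem wp.frame {p : Prog} {Q Q' : State → ℕ → Prop} {σ : State} (h : wp p Q σ)
    (hQ : ∀ σ' t, Frame p σ σ' → Q σ' t → Q' σ' t) : wp p Q' σ := by
  obtain ⟨σ', t, he, hq⟩ := h
  exact ⟨σ', t, he, hQ _ _ ⟨fun _ => he.word_eq, fun _ => he.warr_eq⟩ hq⟩

/-! ### Reading the memory after an assignment -/

section memory
variable (σ : State) (x y : WVar) (z : RVar) (a a' : WArr) (a'' : RArr) (i k : ℕ) (c : ℝ)

@[simp] theorem setW_word : (σ.setW x k).word y = if y = x then k else σ.word y := by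
  simp [State.setW, Function.update_apply]
@[simp] theorem setW_warr : (σ.setW x k).warr = σ.warr := rfl
@[simp] theorem setR_word : (σ.setR z c).word = σ.word := rfl
@[simp] theorem setR_warr : (σ.setR z c).warr = σ.warr := rfl
@[simp] theorem putR_word : (σ.putR a'' i c).word = σ.word := rfl
@[simp] theorem putR_warr : (σ.putR a'' i c).warr = σ.warr := rfl
@[simp] theorem putW_word : (σ.putW a i k).word = σ.word := rfl
@[simp] theorem putW_warr : (σ.putW a i k).warr a' =
    if a' = a then Function.update (σ.warr a') i k else σ.warr a' := by
  by_cases h : a' = a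
  · subst h; simp [State.putW]
  · simp [State.putW, h]
end memory

/-! ### Evaluation of expressions -/

section evaluation
variable (σ : State) (x : WVar) (k : ℕ) (a : WArr) (i e f : WExpr) (t t' : Test)

@[simp] theorem eval_lit : (WExpr.lit k).eval σ = k := rfl
@[simp] theorem eval_var : (WExpr.var x).eval σ = σ.word x := rfl
@[simp] theorem eval_at : (a.at i).eval σ = σ.warr a (i.eval σ) := rfl
@[simp] theorem eval_add : (e + f).eval σ = e.eval σ + f.eval σ := rfl
@[simp] theorem eval_sub : (e - f).eval σ = e.eval σ - f.eval σ := rfl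
@[simp] theorem eval_null : null.eval σ = σ.word .n := rfl
@[simp] theorem eval_sentinel : (sentinel x).eval σ = σ.word .n + 1 + σ.word x := rfl
@[simp] theorem steps_lit : (WExpr.lit k).steps = 1 := rfl
@[simp] theorem steps_var : (WExpr.var x).steps = 1 := rfl
@[simp] theorem steps_at : (a.at i).steps = i.steps + 1 := rfl
@[simp] theorem steps_add : (e + f).steps = e.steps + f.steps + 1 := rfl
@[simp] theorem steps_sub : (e - f).steps = e.steps + f.steps + 1 := rfl
@[simp] theorem steps_null : null.steps = 1 := rfl
@[simp] theorem steps_sentinel : (sentinel x).steps = 5 := rfl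
@[simp] theorem holds_eq : (Test.eq e f).Holds σ ↔ e.eval σ = f.eval σ := Iff.rfl
@[simp] theorem holds_lt : (Test.lt e f).Holds σ ↔ e.eval σ < f.eval σ := Iff.rfl
@[simp] theorem holds_not : (Test.not t).Holds σ ↔ ¬ t.Holds σ := Iff.rfl
@[simp] theorem holds_and : (Test.and t t').Holds σ ↔ t.Holds σ ∧ t'.Holds σ := Iff.rfl
@[simp] theorem test_steps_eq : (Test.eq e f).steps = e.steps + f.steps + 1 := rfl
@[simp] theorem test_steps_lt : (Test.lt e f).steps = e.steps + f.steps + 1 := rfl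
@[simp] theorem test_steps_rlt (e f : RExpr) :
    (Test.rlt e f).steps = e.steps + f.steps + 1 := rfl
@[simp] theorem test_steps_not : (Test.not t).steps = t.steps + 1 := rfl
@[simp] theorem test_steps_and : (Test.and t t').steps = t.steps + t'.steps + 1 := rfl
@[simp] theorem rsteps_zero : RExpr.zero.steps = 1 := rfl
@[simp] theorem rsteps_var (c : RVar) : (RExpr.var c).steps = 1 := rfl
@[simp] theorem rsteps_at (a : RArr) : (a.at i).steps = i.steps + 1 := rfl
@[simp] theorem rsteps_add (e f : RExpr) : (e + f).steps = e.steps + f.steps + 1 := rfl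
@[simp] theorem rsteps_mul (e f : RExpr) : (e * f).steps = e.steps + f.steps + 1 := rfl
end evaluation

/-! ### Doubly linked lists -/

/-- The pointers `nx` and `pv` lead from the cell `a` through the cells `l` to the cell `b`, and
back. -/
def Seg (nx pv : ℕ → ℕ) : ℕ → List ℕ → ℕ → Prop
  | a, [], b => nx a = b ∧ pv b = a
  | a, c :: l, b => nx a = c ∧ pv c = a ∧ Seg nx pv c l b

theorem Seg.congr {nx pv nx' pv' : ℕ → ℕ} {l : List ℕ} : ∀ {a b : ℕ}, Seg nx pv a l b →
    (∀ c ∈ a :: l, nx' c = nx c) → (∀ c ∈ b :: l, pv' c = pv c) → Seg nx' pv' a l b := by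
  induction l with
  | nil => intro a b h h₁ h₂; simp_all [Seg]
  | cons c l ih =>
    intro a b h h₁ h₂
    refine ⟨by simp [h₁, h.1], by simp [h₂, h.2.1], ih h.2.2 (fun d hd => ?_) (fun d hd => ?_)⟩
    · exact h₁ d (List.mem_cons_of_mem _ hd)
    · apply h₂ d; simp only [List.mem_cons] at hd ⊢; tauto

theorem Seg.append {nx pv : ℕ → ℕ} {l l' : List ℕ} {x : ℕ} : ∀ {a b : ℕ},
    Seg nx pv a (l ++ x :: l') b ↔ Seg nx pv a l x ∧ Seg nx pv x l' b := by
  induction l with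
  | nil => intro a b; simp [Seg, and_assoc]
  | cons c l ih => intro a b; simp [Seg, ih, and_assoc]

theorem Seg.prev_mem {nx pv : ℕ → ℕ} {l : List ℕ} : ∀ {a b : ℕ}, Seg nx pv a l b →
    pv b ∈ a :: l := by
  induction l with
  | nil => intro a b h; simp [h.2]
  | cons c l ih => intro a b h; exact List.mem_cons_of_mem _ (ih h.2.2)

theorem Seg.next_mem {nx pv : ℕ → ℕ} {l : List ℕ} {a b : ℕ} (h : Seg nx pv a l b) :
    nx a ∈ b :: l := by
  cases l with
  | nil => simp [h.1]
  | cons c l => simp [h.1]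

/-- The last cell before `x` is redirected to `b`. Here `b` may equal `a`, as happens when the only
cell of a circular list is removed. -/
theorem Seg.retarget {nx pv : ℕ → ℕ} {l : List ℕ} {x b : ℕ} : ∀ {a : ℕ}, Seg nx pv a l x →
    b ∉ l → (a :: l).Nodup → Seg (update nx (pv x) b) (update pv b (pv x)) a l b := by
  induction l with
  | nil => intro a h _ _; simp [Seg, h.2]
  | cons c l ih =>
    intro a h hb hn
    have hm := h.2.2.prev_mem
    rw [List.nodup_cons] at hn
    refine ⟨?_, ?_, ih h.2.2 (fun h => hb (List.mem_cons_of_mem _ h)) hn.2⟩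
    · rw [update_of_ne (fun e : a = pv x => hn.1 (e ▸ hm)), h.1]
    · rw [update_of_ne (fun e => hb (by simp [e])), h.2.1]

theorem Seg.remove {nx pv : ℕ → ℕ} {l l' : List ℕ} {x h : ℕ}
    (hs : Seg nx pv h (l ++ x :: l') h) (hn : (h :: (l ++ x :: l')).Nodup) :
    Seg (update nx (pv x) (nx x)) (update pv (nx x) (pv x)) h (l ++ l') h := by
  obtain ⟨h₁, h₂⟩ := Seg.append.1 hs
  have hn₁ : (h :: l).Nodup := hn.sublist (by simp)
  have hm := h₁.prev_mem
  cases l' with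
  | nil =>
    rw [h₂.1, List.append_nil]
    exact h₁.retarget (by simp_all) hn₁
  | cons c l' =>
    obtain ⟨e₁, e₂, h₃⟩ := h₂
    rw [Seg.append, e₁]
    refine ⟨h₁.retarget ?_ hn₁, h₃.congr ?_ ?_⟩
    · intro hc; rw [List.nodup_cons, List.nodup_append] at hn
      exact hn.2.2.2 c hc c (by simp) rfl
    · intro d hd
      refine update_of_ne (fun e => ?_) _ _
      subst e
      have : (h :: l ++ x :: c :: l').Nodup := by simpa using hn
      exact (List.nodup_append.1 this).2.2 _ hm _ (List.mem_cons_of_mem _ hd) rfl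
    · intro d hd
      refine update_of_ne (fun e => ?_) _ _
      subst e
      rw [List.nodup_cons, List.nodup_append] at hn
      simp at hd hn
      rcases hd with rfl | hd <;> tauto

theorem Seg.insert {nx pv : ℕ → ℕ} {l : List ℕ} {x h : ℕ} (hs : Seg nx pv h l h)
    (hn : (h :: x :: l).Nodup) :
    Seg (update (update nx x (nx h)) h x) (update (update pv x h) (nx h) x) h (x :: l) h := by
  have hxh : x ≠ h := by rintro rfl; simp at hn
  cases l with
  | nil => simp [Seg, hs.1, hxh]
  | cons c l =>
    obtain ⟨e₁, e₂, h₃⟩ := hs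
    simp at hn
    have hcx : x ≠ c := by tauto
    refine ⟨by simp, by simp [e₁, hcx], by simp [hxh, e₁], by simp [e₁], h₃.congr ?_ ?_⟩
    · intro d hd
      rw [update_of_ne, update_of_ne] <;> rintro rfl <;> simp at hd <;> tauto
    · intro d hd
      rw [e₁, update_of_ne, update_of_ne] <;> rintro rfl <;> simp at hd <;> tauto

/-- The sentinel of the list of the children of `o`, or of the list of roots if `o = n`. -/
def cell (n o : ℕ) : ℕ := if o = n then n else n + 1 + o

theorem cell_inj {n o o' : ℕ} (h : cell n o = cell n o') :
    o = o' := by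
  unfold cell at h; split_ifs at h <;> omega

theorem le_cell (n o : ℕ) : n ≤ cell n o := by unfold cell; split_ifs <;> omega

/-- For every owner `o` in `O`, the list `ch o` is stored behind its sentinel, and these lists are
disjoint. -/
structure Lists (n : ℕ) (O : Finset ℕ) (ch : ℕ → List ℕ) (nx pv : ℕ → ℕ) : Prop where
  owner_le : ∀ o ∈ O, o ≤ n
  seg : ∀ o ∈ O, Seg nx pv (cell n o) (ch o) (cell n o)
  lt : ∀ o ∈ O, ∀ x ∈ ch o, x < n
  nodup : ∀ o ∈ O, (ch o).Nodup
  disj : ∀ o ∈ O, ∀ o' ∈ O, ∀ x, x ∈ ch o → x ∈ ch o' → o = o'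

namespace Lists
variable {n : ℕ} {O : Finset ℕ} {ch : ℕ → List ℕ} {nx pv : ℕ → ℕ}

theorem nodup_cell (h : Lists n O ch nx pv) {o : ℕ} (ho : o ∈ O) :
    (cell n o :: ch o).Nodup :=
  List.nodup_cons.2 ⟨fun hc => (h.lt o ho _ hc).not_ge (le_cell n o), h.nodup o ho⟩

/-- Items lie below `n` and sentinels do not, so the lists stay disjoint with their sentinels
included. This is why writing to one list leaves the others intact. -/
theorem disj_cell (h : Lists n O ch nx pv) {o o' : ℕ} (ho : o ∈ O) (ho' : o' ∈ O) {c : ℕ}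
    (hc : c ∈ cell n o :: ch o) (hc' : c ∈ cell n o' :: ch o') : o = o' := by
  simp only [List.mem_cons] at hc hc'
  rcases hc with rfl | hc
  · rcases hc' with hc' | hc'
    · exact cell_inj hc'
    · exact absurd (h.lt o' ho' _ hc') (le_cell n o).not_gt
  · rcases hc' with rfl | hc'
    · exact absurd (h.lt o ho _ hc) (le_cell n o').not_gt
    · exact h.disj o ho o' ho' c hc hc'

theorem mono (h : Lists n O ch nx pv) {O' : Finset ℕ} (hO : O' ⊆ O) : Lists n O' ch nx pv :=
  ⟨fun o ho => h.owner_le o (hO ho), fun o ho => h.seg o (hO ho), fun o ho => h.lt o (hO ho),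
    fun o ho => h.nodup o (hO ho), fun o ho o' ho' => h.disj o (hO ho) o' (hO ho')⟩

theorem remove (h : Lists n O ch nx pv) {o x : ℕ} (ho : o ∈ O) (hx : x ∈ ch o) :
    Lists n O (update ch o ((ch o).erase x))
      (update nx (pv x) (nx x)) (update pv (nx x) (pv x)) := by
  have hsub : ∀ o' y, y ∈ update ch o ((ch o).erase x) o' → y ∈ ch o' := by
    intro o' y hy
    by_cases e : o' = o
    · subst e; rw [update_self] at hy; exact List.mem_of_mem_erase hy
    · rwa [update_of_ne e] at hy
  obtain ⟨l, l', hl⟩ := List.append_of_mem hx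
  have hseg := h.seg o ho
  have hn := h.nodup_cell ho
  rw [hl] at hseg
  have hpv : pv x ∈ cell n o :: ch o := by
    have := (Seg.append.1 hseg).1.prev_mem
    rw [hl]; simp only [List.mem_cons, List.mem_append] at this ⊢; tauto
  have hnx : nx x ∈ cell n o :: ch o := by
    have := (Seg.append.1 hseg).2.next_mem
    rw [hl]; simp only [List.mem_cons, List.mem_append] at this ⊢; tauto
  refine ⟨h.owner_le, fun o' ho' => ?_, fun o' ho' y hy => h.lt o' ho' y (hsub _ _ hy),
    fun o' ho' => ?_, fun o₁ h₁ o₂ h₂ y hy₁ hy₂ => h.disj o₁ h₁ o₂ h₂ y (hsub _ _ hy₁)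
      (hsub _ _ hy₂)⟩
  · by_cases e : o' = o
    · subst e
      rw [hl] at hn
      have hxl : x ∉ l := by
        intro hx; rw [List.nodup_cons, List.nodup_append] at hn
        exact hn.2.2.2 x hx x (by simp) rfl
      rw [update_self, hl, List.erase_append_right _ hxl, List.erase_cons_head]
      exact hseg.remove hn
    · rw [update_of_ne e]
      refine (h.seg o' ho').congr ?_ ?_
      · intro c hc
        exact update_of_ne (fun e' : c = pv x => e (h.disj_cell ho' ho hc (e' ▸ hpv))) _ _
      · intro c hc
        exact update_of_ne (fun e' : c = nx x => e (h.disj_cell ho' ho hc (e' ▸ hnx))) _ _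
  · by_cases e : o' = o
    · subst e; rw [update_self]; exact (h.nodup _ ho).erase _
    · rw [update_of_ne e]; exact h.nodup _ ho'

theorem insert (h : Lists n O ch nx pv) {o x : ℕ} (ho : o ∈ O) (hx : x < n)
    (hxc : ∀ o ∈ O, x ∉ ch o) :
    Lists n O (update ch o (x :: ch o)) (update (update nx x (nx (cell n o))) (cell n o) x)
      (update (update pv x (cell n o)) (nx (cell n o)) x) := by
  have hmem : ∀ o' y, y ∈ update ch o (x :: ch o) o' → y = x ∧ o' = o ∨ y ∈ ch o' := by
    intro o' y hy
    by_cases e : o' = o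
    · subst e; rw [update_self] at hy; simp only [List.mem_cons] at hy; tauto
    · rw [update_of_ne e] at hy; exact Or.inr hy
  have hn := h.nodup_cell ho
  have hxo : ∀ o' ∈ O, x ∉ cell n o' :: ch o' := by
    intro o' ho' hm
    simp only [List.mem_cons] at hm
    rcases hm with rfl | hm
    · exact absurd hx (le_cell n o').not_gt
    · exact hxc o' ho' hm
  have hnx : nx (cell n o) ∈ cell n o :: ch o := (h.seg o ho).next_mem
  refine ⟨h.owner_le, fun o' ho' => ?_, fun o' ho' y hy => ?_, fun o' ho' => ?_,
    fun o₁ h₁ o₂ h₂ y hy₁ hy₂ => ?_⟩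
  · by_cases e : o' = o
    · subst e
      rw [update_self]
      refine (h.seg _ ho).insert ?_
      have := hxo _ ho
      simp only [List.nodup_cons, List.mem_cons, not_or] at this hn ⊢
      exact ⟨⟨Ne.symm this.1, hn.1⟩, this.2, hn.2⟩
    · rw [update_of_ne e]
      refine (h.seg o' ho').congr ?_ ?_
      · intro c hc
        rw [update_of_ne, update_of_ne]
        · rintro rfl; exact hxo o' ho' hc
        · rintro rfl; exact e (h.disj_cell ho' ho hc (by simp))
      · intro c hc
        rw [update_of_ne, update_of_ne]
        · rintro rfl; exact hxo o' ho' hc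
        · rintro rfl; exact e (h.disj_cell ho' ho hc hnx)
  · rcases hmem _ _ hy with ⟨rfl, rfl⟩ | hy
    · exact hx
    · exact h.lt o' ho' y hy
  · by_cases e : o' = o
    · subst e; rw [update_self]; exact List.nodup_cons.2 ⟨hxc _ ho, h.nodup _ ho⟩
    · rw [update_of_ne e]; exact h.nodup _ ho'
  · rcases hmem _ _ hy₁ with ⟨rfl, rfl⟩ | hm₁
    · rcases hmem _ _ hy₂ with ⟨_, rfl⟩ | hm₂
      · rfl
      · exact absurd hm₂ (hxc _ h₂)
    · rcases hmem _ _ hy₂ with ⟨rfl, rfl⟩ | hm₂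
      · exact absurd hm₁ (hxc _ h₁)
      · exact h.disj o₁ h₁ o₂ h₂ y hm₁ hm₂

theorem new (h : Lists n O ch nx pv) {v : ℕ} (hv : v < n) (hvO : v ∉ O) :
    Lists n (Insert.insert v O) (update ch v [])
      (update nx (n + 1 + v) (n + 1 + v)) (update pv (n + 1 + v) (n + 1 + v)) := by
  have hc : cell n v = n + 1 + v := if_neg hv.ne
  have key : ∀ o ∈ Insert.insert v O, o = v ∧ update ch v [] o = [] ∨
      o ∈ O ∧ o ≠ v ∧ update ch v [] o = ch o := by
    intro o ho
    by_cases e : o = v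
    · subst e; simp
    · right; rw [update_of_ne e]; simp_all
  refine ⟨fun o ho => ?_, fun o ho => ?_, fun o ho x hx => ?_, fun o ho => ?_,
    fun o ho o' ho' x hx hx' => ?_⟩
  · rcases key o ho with ⟨rfl, _⟩ | ⟨ho, _⟩
    · exact hv.le
    · exact h.owner_le o ho
  · rcases key o ho with ⟨rfl, e⟩ | ⟨ho, hne, e⟩
    · rw [e, hc]; simp [Seg]
    · have hd : ∀ c ∈ cell n o :: ch o, c ≠ n + 1 + v := by
        rintro c hc' rfl
        simp only [List.mem_cons] at hc'
        rcases hc' with hc' | hc'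
        · exact hne (cell_inj (by rw [hc, hc']))
        · have := h.lt o ho _ hc'; omega
      rw [e]
      exact (h.seg o ho).congr (fun c hc => update_of_ne (hd c hc) _ _)
        (fun c hc => update_of_ne (hd c hc) _ _)
  · rcases key o ho with ⟨_, e⟩ | ⟨ho, _, e⟩ <;> rw [e] at hx
    · simp at hx
    · exact h.lt o ho x hx
  · rcases key o ho with ⟨_, e⟩ | ⟨ho, _, e⟩ <;> rw [e]
    · simp
    · exact h.nodup o ho
  · rcases key o ho with ⟨_, e⟩ | ⟨ho, _, e⟩ <;> rw [e] at hx
    · simp at hx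
    · rcases key o' ho' with ⟨_, e'⟩ | ⟨ho', _, e'⟩ <;> rw [e'] at hx'
      · simp at hx'
      · exact h.disj o ho o' ho' x hx hx'

end Lists

/-! ### The shape of the forest -/

/-- If the children of a node, the last linked one first, are `l`, then each child has at least the
value that is the number of children linked before it. -/
def Fib (val : ℕ → ℕ) : List ℕ → Prop
  | [] => True
  | c :: l => l.length ≤ val c ∧ Fib val l

theorem Fib.mono {val val' : ℕ → ℕ} {l : List ℕ} (h : Fib val l)
    (hv : ∀ c ∈ l, val c ≤ val' c) : Fib val' l := by
  induction l with
  | nil => trivial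
  | cons c l ih =>
    exact ⟨h.1.trans (hv c (by simp)), ih h.2 fun d hd => hv d (List.mem_cons_of_mem _ hd)⟩

theorem Fib.sublist {val : ℕ → ℕ} {l l' : List ℕ} (hl : l'.Sublist l) (h : Fib val l) :
    Fib val l' := by
  induction hl with
  | slnil => trivial
  | cons a _ ih => exact ih h.2
  | cons_cons a hl ih => exact ⟨hl.length_le.trans h.1, ih h.2⟩

/-- The recursion F(l+3) = F(l+1) + F(l+2) matches adding one child: with l children before it, the
new child has rank at least l - 1 and so contributes at least F(l+1). -/
theorem Fib.fib_le {val : ℕ → ℕ} {rk : ℕ → ℕ} {l : List ℕ} (h : Fib val l)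
    (hv : ∀ c ∈ l, val c ≤ rk c + 1) :
    Nat.fib (l.length + 2) ≤ 1 + (l.map fun c => Nat.fib (rk c + 2)).sum := by
  induction l with
  | nil => simp
  | cons c l ih =>
    have h₁ := ih h.2 fun d hd => hv d (List.mem_cons_of_mem _ hd)
    have h₂ : Nat.fib (l.length + 1) ≤ Nat.fib (rk c + 2) :=
      Nat.fib_mono (by have := h.1; have := hv c (by simp); omega)
    have h₃ : Nat.fib (l.length + 3) = Nat.fib (l.length + 1) + Nat.fib (l.length + 2) :=
      Nat.fib_add_two
    simp only [List.length_cons, List.map_cons, List.sum_cons]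
    rw [show l.length + 1 + 2 = l.length + 3 by ring]
    omega

/-- Summing over all items of a forest with the children `ch` and the roots `ch n` bounds the number
of children of the roots. -/
theorem sum_fib_roots_le {n : ℕ} {A : Finset ℕ} {ch : ℕ → List ℕ} {par val : ℕ → ℕ}
    (hnA : n ∉ A)
    (hnodup : ∀ o ∈ insert n A, (ch o).Nodup)
    (hmem : ∀ o ∈ insert n A, ∀ x, x ∈ ch o ↔ x ∈ A ∧ par x = o)
    (hpar : ∀ x ∈ A, par x ∈ insert n A)
    (hfib : ∀ x ∈ A, Fib val (ch x)) (hval : ∀ x ∈ A, val x ≤ (ch x).length + 1) :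
    ∑ x ∈ (ch n).toFinset, Nat.fib ((ch x).length + 2) ≤ A.card := by
  set f : ℕ → ℕ := fun x => Nat.fib ((ch x).length + 2) with hf
  have hset : ∀ o ∈ insert n A, (ch o).toFinset = A.filter fun x => par x = o := by
    intro o ho; ext x; simp [hmem o ho]
  have h₁ : ∑ x ∈ A, f x ≤ ∑ x ∈ A, (1 + ∑ y ∈ A.filter fun y => par y = x, f y) := by
    refine Finset.sum_le_sum fun x hx => ?_
    have hx' : x ∈ insert n A := Finset.mem_insert_of_mem hx
    have := (hfib x hx).fib_le (rk := fun c => (ch c).length)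
      (fun c hc => hval c ((hmem x hx' c).1 hc).1)
    rwa [← hset x hx', List.sum_toFinset f (hnodup x hx')]
  change ∑ x ∈ (ch n).toFinset, f x ≤ A.card
  -- Each non-root occurs in exactly one child sum, so the non-roots cancel against `h₁` and the
  -- roots are left with at most |A|. This replaces induction over trees and does not need the
  -- parent pointers to be acyclic.
  have h₂ : ∑ x ∈ A, f x = ∑ o ∈ insert n A, ∑ y ∈ A.filter fun y => par y = o, f y :=
    (Finset.sum_fiberwise_of_maps_to hpar f).symm
  rw [Finset.sum_insert hnA, ← hset n (by simp)] at h₂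
  rw [Finset.sum_add_distrib, Finset.sum_const, smul_eq_mul, mul_one] at h₁
  omega

theorem two_pow_le_fib (k : ℕ) : 2 ^ (k / 2) ≤ Nat.fib (k + 2) := by
  induction k using Nat.twoStepInduction with
  | zero => simp
  | one => simp [Nat.fib_add_two]
  | more k ih _ =>
    have h₁ : Nat.fib (k + 4) = Nat.fib (k + 2) + Nat.fib (k + 3) := Nat.fib_add_two
    have h₂ : Nat.fib (k + 2) ≤ Nat.fib (k + 3) := Nat.fib_mono (by omega)
    rw [show (k + 2) / 2 = k / 2 + 1 by omega, pow_succ]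
    simp only [show k + 2 + 2 = k + 4 by ring]
    omega

theorem le_of_fib_le {k n : ℕ} (h : Nat.fib (k + 2) ≤ n) : k ≤ 2 * Nat.log 2 n + 1 := by
  have := Nat.le_log_of_pow_le (by norm_num) ((two_pow_le_fib k).trans h)
  omega

/-! ### Operations on lists in the memory -/

/-- The memory after the cell `x` was removed from its list. -/
def State.detach (σ : State) (x : ℕ) : State :=
  (σ.putW .next (σ.warr .prev x) (σ.warr .next x)).putW .prev (σ.warr .next x) (σ.warr .prev x)

/-- The memory after the cell `x` was inserted behind the cell `h`. -/
def State.attach (σ : State) (h x : ℕ) : State :=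
  (((σ.putW .next x (σ.warr .next h)).putW .prev x h).putW .prev (σ.warr .next h) x).putW .next h x

-- Rereading a cell after a write that may have hit it: the value written is the one stored there
-- already.
@[simp] theorem update_read (f : ℕ → ℕ) (i k : ℕ) : update f i (f k) k = f k := by
  simp [update_apply]

section
variable (σ : State) (h k : ℕ)

@[simp] theorem detach_word : (σ.detach k).word = σ.word := rfl
@[simp] theorem attach_word : (σ.attach h k).word = σ.word := rfl
@[simp] theorem detach_next : (σ.detach k).warr .next =
    update (σ.warr .next) (σ.warr .prev k) (σ.warr .next k) := by simp [State.detach]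
@[simp] theorem detach_prev : (σ.detach k).warr .prev =
    update (σ.warr .prev) (σ.warr .next k) (σ.warr .prev k) := by simp [State.detach]
@[simp] theorem attach_next : (σ.attach h k).warr .next =
    update (update (σ.warr .next) k (σ.warr .next h)) h k := by simp [State.attach]
@[simp] theorem attach_prev : (σ.attach h k).warr .prev =
    update (update (σ.warr .prev) k h) (σ.warr .next h) k := by simp [State.attach]

theorem detach_warr {a : WArr} (h₁ : a ≠ .next) (h₂ : a ≠ .prev) :
    (σ.detach k).warr a = σ.warr a := by simp [State.detach, h₁, h₂]
theorem attach_warr {a : WArr} (h₁ : a ≠ .next) (h₂ : a ≠ .prev) :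
    (σ.attach h k).warr a = σ.warr a := by simp [State.attach, h₁, h₂]

@[simp] theorem detach_parent : (σ.detach k).warr .parent = σ.warr .parent := by
  simp [detach_warr]
@[simp] theorem detach_degree : (σ.detach k).warr .degree = σ.warr .degree := by
  simp [detach_warr]
@[simp] theorem detach_mark : (σ.detach k).warr .mark = σ.warr .mark := by
  simp [detach_warr]
@[simp] theorem detach_bucket : (σ.detach k).warr .bucket = σ.warr .bucket := by
  simp [detach_warr]
@[simp] theorem attach_parent : (σ.attach h k).warr .parent = σ.warr .parent := by
  simp [attach_warr]
@[simp] theorem attach_degree : (σ.attach h k).warr .degree = σ.warr .degree := by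
  simp [attach_warr]
@[simp] theorem attach_mark : (σ.attach h k).warr .mark = σ.warr .mark := by
  simp [attach_warr]

end

@[simp] theorem wp_listRemove {Q : State → ℕ → Prop} {σ : State} {x : WVar} :
    wp (listRemove x) Q σ ↔ Q (σ.detach (σ.word x)) 10 := by
  simp [listRemove, State.detach]

@[simp] theorem wp_listInsert_null {Q : State → ℕ → Prop} {σ : State} {x : WVar} :
    wp (listInsert null x) Q σ ↔ Q (σ.attach (σ.word .n) (σ.word x)) 14 := by
  simp [listInsert, State.attach]

@[simp] theorem wp_listInsert_sentinel {Q : State → ℕ → Prop} {σ : State} {x y : WVar} :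
    wp (listInsert (sentinel y) x) Q σ ↔
      Q (σ.attach (σ.word .n + 1 + σ.word y) (σ.word x)) 30 := by
  simp [listInsert, State.attach]

/-! ### The forest in the memory -/

/-- The memory holds a forest on the set `A` of items; the list of the children of `x` is `ch x`,
and the list of roots is `ch n`. -/
structure Forest (n : ℕ) (A : Finset ℕ) (ch : ℕ → List ℕ) (σ : State) : Prop where
  lists : Lists n (insert n A) ch (σ.warr .next) (σ.warr .prev)
  mem : ∀ o ∈ insert n A, ∀ x, x ∈ ch o ↔ x ∈ A ∧ σ.warr .parent x = o
  par_mem : ∀ x ∈ A, σ.warr .parent x ∈ insert n A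

/-- The children after `x` was moved from `o` to `o'`. -/
def moved (ch : ℕ → List ℕ) (x o o' : ℕ) : ℕ → List ℕ :=
  update (update ch o ((ch o).erase x)) o' (x :: ch o')

namespace Forest
variable {n : ℕ} {A : Finset ℕ} {ch : ℕ → List ℕ} {σ : State}

theorem congr (h : Forest n A ch σ) {σ' : State} (h₁ : σ'.warr .next = σ.warr .next)
    (h₂ : σ'.warr .prev = σ.warr .prev) (h₃ : σ'.warr .parent = σ.warr .parent) :
    Forest n A ch σ' :=
  ⟨by rw [h₁, h₂]; exact h.lists, by rw [h₃]; exact h.mem, by rw [h₃]; exact h.par_mem⟩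

theorem lt (h : Forest n A ch σ) {x : ℕ} (hx : x ∈ A) : x < n :=
  h.lists.lt _ (h.par_mem x hx) x ((h.mem _ (h.par_mem x hx) x).2 ⟨hx, rfl⟩)

theorem notMem (h : Forest n A ch σ) : n ∉ A := fun hn => (h.lt hn).ne rfl

theorem mem_root (h : Forest n A ch σ) {x : ℕ} :
    x ∈ ch n ↔ x ∈ A ∧ σ.warr .parent x = n := h.mem n (by simp) x

/-- A cut, a link and the release of a child during extraction are all this one move; only the
owners `o` and `o'` differ. -/
theorem move (h : Forest n A ch σ) {x o o' : ℕ} (hx : x ∈ A) (ho : σ.warr .parent x = o)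
    (ho' : o' ∈ insert n A) (hne : o ≠ o') :
    Forest n A (moved ch x o o')
      (((σ.detach x).attach (cell n o') x).putW .parent x o') := by
  have hoA : o ∈ insert n A := ho ▸ h.par_mem x hx
  have hxo : x ∈ ch o := (h.mem o hoA x).2 ⟨hx, ho⟩
  have h₁ := h.lists.remove hoA hxo
  have key : ∀ o'' ∈ insert n A, x ∉ update ch o ((ch o).erase x) o'' := by
    intro o'' h'' hm
    by_cases e : o'' = o
    · subst e; rw [update_self] at hm; exact (h.lists.nodup _ h'').not_mem_erase hm
    · rw [update_of_ne e] at hm; exact e (h.lists.disj _ h'' _ hoA x hm hxo)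
  refine ⟨?_, ?_, ?_⟩
  · have := h₁.insert ho' (h.lt hx) key
    rw [update_of_ne hne.symm] at this
    simpa [moved] using this
  · intro o'' h'' z
    simp only [putW_warr, if_true, attach_parent, detach_parent, moved]
    by_cases hz : z = x
    · subst hz
      rw [update_self]
      by_cases e : o'' = o'
      · subst e; simp [hx]
      · rw [update_of_ne e]
        exact iff_of_false (key o'' h'') (fun hh => e hh.2.symm)
    · rw [update_of_ne hz, ← h.mem o'' h'' z]
      by_cases e : o'' = o'
      · subst e; simp [hz]
      · rw [update_of_ne e]
        by_cases e : o'' = o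
        · subst e; rw [update_self, List.mem_erase_of_ne hz]
        · rw [update_of_ne e]
  · intro z hz
    simp only [putW_warr, if_true, attach_parent, detach_parent]
    by_cases hzx : z = x
    · subst hzx; rw [update_self]; exact ho'
    · rw [update_of_ne hzx]; exact h.par_mem z hz

/-- Removing a root without children. -/
theorem removeRoot (h : Forest n A ch σ) {u : ℕ} (hu : u ∈ ch n) (hch : ch u = []) :
    Forest n (A.erase u) (update ch n ((ch n).erase u)) (σ.detach u) := by
  have hnA := h.notMem
  have huA := (h.mem_root.1 hu).1
  have h₁ := h.lists.remove (by simp) hu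
  refine ⟨?_, ?_, ?_⟩
  · simpa using h₁.mono (Finset.insert_subset_insert n (Finset.erase_subset u A))
  · intro o ho z
    have ho' : o ∈ insert n A := Finset.insert_subset_insert n (Finset.erase_subset u A) ho
    have hm := h.mem o ho' z
    simp only [detach_parent, Finset.mem_erase]
    by_cases e : o = n
    · subst e
      rw [update_self, (h.lists.nodup _ (by simp)).mem_erase_iff, hm]; tauto
    · rw [update_of_ne e, hm]
      constructor
      · rintro ⟨hz, hp⟩
        refine ⟨⟨?_, hz⟩, hp⟩
        rintro rfl; exact e (hp ▸ (h.mem_root.1 hu).2)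
      · rintro ⟨⟨_, hz⟩, hp⟩; exact ⟨hz, hp⟩
  · intro z hz
    simp only [detach_parent]
    have hz := Finset.mem_of_mem_erase hz
    have hp := h.par_mem z hz
    have : σ.warr .parent z ≠ u := by
      intro e
      have := (h.mem u (by simp [huA]) z).2 ⟨hz, e⟩
      simp [hch] at this
    simp only [Finset.mem_insert, Finset.mem_erase] at hp ⊢; tauto

/-- Inserting a root without children. -/
theorem insertRoot (h : Forest n A ch σ) {v : ℕ} (hv : v < n) (hvA : v ∉ A) :
    Forest n (insert v A) (update (update ch v []) n (v :: ch n))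
      ((((σ.putW .next (n + 1 + v) (n + 1 + v)).putW .prev (n + 1 + v) (n + 1 + v)).putW
        .parent v n).attach n v) := by
  have h₁ := h.lists.new hv (by simp [hv.ne, hvA])
  rw [Finset.insert_comm] at h₁
  have key : ∀ o ∈ insert n (insert v A), v ∉ update ch v [] o := by
    intro o ho hm
    by_cases e : o = v
    · subst e; simp at hm
    · rw [update_of_ne e] at hm
      exact hvA ((h.mem o (by simp_all) v).1 hm).1
  have h₂ := h₁.insert (o := n) (by simp) hv key
  rw [update_of_ne hv.ne'] at h₂
  refine ⟨?_, ?_, ?_⟩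
  · simpa [cell] using h₂
  · intro o ho z
    simp only [attach_parent, putW_warr, if_true]
    simp only [reduceCtorEq, if_false]
    by_cases hz : z = v
    · subst hz
      rw [update_self]
      by_cases e : o = n
      · subst e; simp
      · rw [update_of_ne e]
        exact iff_of_false (key o ho) fun hh => e hh.2.symm
    · rw [update_of_ne hz]
      by_cases e : o = n
      · subst e; simp [hz, h.mem_root]
      · rw [update_of_ne e]
        by_cases e' : o = v
        · subst e'
          simp only [update_self, List.not_mem_nil, false_iff, not_and]
          intro hzA hp
          have := h.par_mem z (by simp_all)
          simp_all
        · rw [update_of_ne e', h.mem o (by simp_all)]; simp [hz]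
  · intro z hz
    simp only [attach_parent, putW_warr, if_true]
    simp only [reduceCtorEq, if_false]
    by_cases e : z = v
    · subst e; simp
    · rw [update_of_ne e]
      have := h.par_mem z (by simp_all)
      simp only [Finset.mem_insert] at this ⊢; tauto

end Forest

/-! ### The heap invariant and the degree bound. -/

/-- A lower bound for the number of children that `c` had when it was linked, if `d` is the only
item that may have lost an unrecorded child. -/
def linkRank (ch : ℕ → List ℕ) (mk : ℕ → ℕ) (d c : ℕ) : ℕ :=
  (ch c).length + (if mk c = 1 then 1 else 0) + (if c = d then 1 else 0)

/-- The invariant of the Fibonacci heap on the set `A` of items. The degree of `ex` need not be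
correct, and `d` may have lost a child without having been marked. -/
structure HeapInv (n : ℕ) (A : Finset ℕ) (ch : ℕ → List ℕ) (d ex : ℕ) (σ : State) : Prop where
  n_eq : σ.word .n = n
  forest : Forest n A ch σ
  deg : ∀ x ∈ A, x ≠ ex → σ.warr .degree x = (ch x).length
  fib : ∀ z ∈ A, Fib (linkRank ch (σ.warr .mark) d) (ch z)

/-- The number of marked items that are not roots. -/
def marked (n : ℕ) (A : Finset ℕ) (σ : State) : ℕ :=
  (A.filter fun x => σ.warr .parent x ≠ n ∧ σ.warr .mark x = 1).card

namespace HeapInv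
variable {n : ℕ} {A : Finset ℕ} {ch : ℕ → List ℕ} {σ : State} {d ex : ℕ}

theorem congr (h : HeapInv n A ch d ex σ) {σ' : State} (h₀ : σ'.word .n = σ.word .n)
    (h₁ : σ'.warr .next = σ.warr .next)
    (h₂ : σ'.warr .prev = σ.warr .prev) (h₃ : σ'.warr .parent = σ.warr .parent)
    (h₄ : σ'.warr .degree = σ.warr .degree) (h₅ : σ'.warr .mark = σ.warr .mark) :
    HeapInv n A ch d ex σ' :=
  ⟨h₀.trans h.n_eq, h.forest.congr h₁ h₂ h₃, h₄ ▸ h.deg, h₅ ▸ h.fib⟩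

/-- Since `n` is not an item, `d = n` excuses nobody, and `linkRank` exceeds the number of children
by at most the mark. -/
theorem sum_fib_le (h : HeapInv n A ch n ex σ) :
    ∑ x ∈ (ch n).toFinset, Nat.fib ((ch x).length + 2) ≤ A.card := by
  have hn := h.forest.notMem
  refine sum_fib_roots_le hn h.forest.lists.nodup h.forest.mem h.forest.par_mem h.fib
    fun x hx => ?_
  have : x ≠ n := fun e => hn (e ▸ hx)
  simp only [linkRank, this, if_false]
  split_ifs <;> omega

theorem card_le (h : HeapInv n A ch d ex σ) : A.card ≤ n := by
  simpa using Finset.card_le_card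
    (show A ⊆ Finset.range n from fun x hx => Finset.mem_range.2 (h.forest.lt hx))

theorem degree_le (h : HeapInv n A ch n ex σ) {x : ℕ} (hx : x ∈ ch n) :
    (ch x).length ≤ 2 * Nat.log 2 n + 1 := by
  refine le_of_fib_le (le_trans ?_ (h.sum_fib_le.trans h.card_le))
  exact Finset.single_le_sum (f := fun x => Nat.fib ((ch x).length + 2))
    (fun _ _ => Nat.zero_le _) (List.mem_toFinset.2 hx)

/-- Keeps the degrees of roots among the bucket indices `0, …, n - 1`. A root has parent `n`, so it
is not among its own children. -/
theorem length_lt (h : HeapInv n A ch d ex σ) {x : ℕ} (hx : x ∈ ch n) :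
    (ch x).length < n := by
  obtain ⟨hxA, hp⟩ := h.forest.mem_root.1 hx
  have hxi : x ∈ insert n A := by simp [hxA]
  have hsub : (ch x).toFinset ⊆ A.erase x := by
    intro z hz
    obtain ⟨hz, hzp⟩ := (h.forest.mem x hxi z).1 (List.mem_toFinset.1 hz)
    refine Finset.mem_erase.2 ⟨?_, hz⟩
    rintro rfl
    exact (h.forest.lt hxA).ne (hzp.symm.trans hp)
  have := Finset.card_le_card hsub
  rw [List.toFinset_card_of_nodup (h.forest.lists.nodup x hxi), Finset.card_erase_of_mem hxA] at this
  have := h.card_le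
  have := (Finset.card_pos.2 ⟨x, hxA⟩)
  omega

end HeapInv

/-! ### The operations of the Fibonacci heap -/

/-- The minimum pointer is null if there are no roots, and points to a root otherwise. -/
def MinOk (n : ℕ) (ch : ℕ → List ℕ) (σ : State) : Prop :=
  σ.word .min = n ∧ ch n = [] ∨ σ.word .min ∈ ch n

/-- The potential of the heap, measured in steps. -/
def pot (n : ℕ) (A : Finset ℕ) (ch : ℕ → List ℕ) (σ : State) : ℕ :=
  300 * (ch n).length + 500 * marked n A σ

theorem marked_congr {n : ℕ} {A : Finset ℕ} {σ σ' : State}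
    (h₁ : σ'.warr .parent = σ.warr .parent) (h₂ : σ'.warr .mark = σ.warr .mark) :
    marked n A σ' = marked n A σ := by simp only [marked, h₁, h₂]

/-- Either candidate may win the key comparison. The old minimum survives only if it was not null.
-/
theorem wp_updateMin {r : WVar} {σ : State} {Q : State → ℕ → Prop}
    (h : ∀ k t, k = σ.word r ∨ k = σ.word .min ∧ σ.word .min ≠ σ.word .n → t ≤ 20 →
      Q (σ.setW .min k) t) : wp (updateMin r) Q σ := by
  unfold updateMin
  refine wp_ite (fun _ => ?_) (fun hm => wp_ite (fun _ => ?_) (fun _ => ?_))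
  · simpa using h _ 6 (Or.inl rfl)
  · simpa using h _ 12 (Or.inl rfl)
  · have e : σ.setW .min (σ.word .min) = σ := by simp [State.setW]
    have := h _ 10 (Or.inr ⟨rfl, hm⟩)
    rw [e] at this
    simpa using this

/-! ### Cuts and decrease-key. -/

section
variable {n : ℕ} {A : Finset ℕ} {ch : ℕ → List ℕ} {σ : State} {d : ℕ}

theorem moved_same {x o o' : ℕ} : moved ch x o o' o' = x :: ch o' := by simp [moved]

/-- `y` has lost a child without being marked, so it becomes the exception `d`. The former exception
can only be `x`, now a root and thus subject to no rank condition. Losing a child shortens a list,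
which `Fib.sublist` tolerates. -/
theorem heapCut_spec {x y : ℕ} (h : HeapInv n A ch d n σ) (hd : d = n ∨ d = x)
    (hxw : σ.word .x = x) (hyw : σ.word .y = y)
    (hx : x ∈ A) (hy : y ∈ A) (hp : σ.warr .parent x = y) :
    wp heapCut (fun σ' t => t ≤ 50 ∧ HeapInv n A (moved ch x y n) y n σ' ∧
      σ'.warr .parent x = n ∧
      marked n A σ' + (if σ.warr .mark x = 1 then 1 else 0) ≤ marked n A σ) σ := by
  have hyn : y ≠ n := fun e => h.forest.notMem (e ▸ hy)
  have hxn : x ≠ n := fun e => h.forest.notMem (e ▸ hx)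
  have hxy : x ∈ ch y := (h.forest.mem y (by simp [hy]) x).2 ⟨hx, hp⟩
  have hlen := List.length_erase_of_mem hxy
  have hpos := List.length_pos_of_mem hxy
  have hf := h.forest.move hx hp (o' := n) (by simp) hyn
  have hch : ∀ z ∈ A, moved ch x y n z = if z = y then (ch y).erase x else ch z := by
    intro z hz
    have hzn : z ≠ n := fun e => h.forest.notMem (e ▸ hz)
    rw [moved, update_of_ne hzn]
    split_ifs with e
    · subst e; simp
    · rw [update_of_ne e]
  simp only [heapCut, wp_block_cons, wp_block_nil, wp_listRemove, wp_listInsert_null, wp_putW]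
  refine ⟨by simp, ⟨by simp [h.n_eq], ?_, ?_, ?_⟩, ?_, ?_⟩
  · refine hf.congr ?_ ?_ ?_ <;> simp [hxw, hyw, h.n_eq, cell]
  · intro z hz hzn
    rw [hch z hz]
    have h₁ := h.deg z hz hzn
    by_cases e : z = y
    · subst e; simp [hyw, h₁, hlen]
    · simp [hyw, e, h₁]
  · intro z hz
    have hzn : z ≠ n := fun e => h.forest.notMem (e ▸ hz)
    have hsub : (moved ch x y n z).Sublist (ch z) := by
      rw [hch z hz]; split_ifs with e
      · subst e; exact List.erase_sublist
      · exact List.Sublist.refl _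
    refine ((h.fib z hz).sublist hsub).mono fun c hc => ?_
    obtain ⟨hcA, hcp⟩ := (hf.mem z (by simp [hz]) c).1 hc
    have hcx : c ≠ x := by
      rintro rfl; simp at hcp; exact hzn hcp.symm
    have hcn : c ≠ n := fun e => h.forest.notMem (e ▸ hcA)
    have hcd : c ≠ d := by rintro rfl; tauto
    have hm : ∀ f : ℕ → ℕ, update f x 0 c = f c := fun f => update_of_ne hcx _ _
    simp only [linkRank, putW_warr, hch c hcA, hcd, if_false, if_true, hxw]
    simp only [reduceCtorEq, if_false, attach_mark, putW_warr, detach_mark, eval_lit, putW_word,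
      attach_word, detach_word, eval_var, hxw, hm]
    split_ifs <;> simp_all <;> omega
  · simp [hxw, h.n_eq]
  · have hsub : ∀ τ : State, (τ.warr .parent = update (σ.warr .parent) x n) →
        τ.warr .mark = update (σ.warr .mark) x 0 →
        marked n A τ + (if σ.warr .mark x = 1 then 1 else 0) ≤ marked n A σ := by
      intro τ h₁ h₂
      have hs : (A.filter fun z => τ.warr .parent z ≠ n ∧ τ.warr .mark z = 1) ⊆
          (A.filter fun z => σ.warr .parent z ≠ n ∧ σ.warr .mark z = 1).erase x := by
        intro z hz
        by_cases e : z = x <;> simp_all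
      have hc := Finset.card_le_card hs
      unfold marked
      split_ifs with hm
      · have hxm : x ∈ A.filter fun z => σ.warr .parent z ≠ n ∧ σ.warr .mark z = 1 := by
          simp [hx, hp, hyn, hm]
        have := Finset.card_pos.2 ⟨x, hxm⟩
        rw [Finset.card_erase_of_mem hxm] at hc
        omega
      · exact hc.trans (Finset.card_le_card (Finset.erase_subset _ _))
    apply hsub <;> simp [hxw, h.n_eq]

/-- Each iteration removes a mark and creates a root: 500 is released, 300 is bound, and the
remaining 200 pays for the steps. The exit may set one mark, whence 600. That old roots remain roots
keeps the minimum pointer valid. -/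
theorem heapCascadingCut_spec {y : ℕ} (h : HeapInv n A ch y n σ) (hyw : σ.word .y = y)
    (hy : y ∈ A) :
    wp heapCascadingCut (fun σ' t => ∃ ch', HeapInv n A ch' n n σ' ∧ ch n ⊆ ch' n ∧
      t + pot n A ch' σ' ≤ 600 + pot n A ch σ) σ := by
  subst hyw
  simp only [heapCascadingCut, wp_block_cons, wp_block_nil]
  refine (wp_loop (fun τ k => ∃ ch', HeapInv n A ch' (τ.word .y) n τ ∧ τ.word .y ∈ A ∧
    ch n ⊆ ch' n ∧ k = pot n A ch' τ) ?_ _ _ ⟨ch, h, hy, fun _ h => h, rfl⟩).mono ?_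
  · rintro τ k ⟨ch', hτ, hyτ, hsub, rfl⟩ hb
    simp only [holds_and, holds_not, holds_eq, eval_at, eval_var, eval_null, eval_lit, hτ.n_eq]
      at hb
    have hpA : τ.warr .parent (τ.word .y) ∈ A := by
      have := hτ.forest.par_mem _ hyτ
      simp only [Finset.mem_insert, hb.1, false_or] at this
      exact this
    simp only [wp_block_cons, wp_block_nil, wp_setW]
    have hinv : HeapInv n A ch' (τ.word .y) n
        ((τ.setW .x (τ.word .y)).setW .y (τ.warr .parent (τ.word .y))) :=
      hτ.congr (by simp) rfl rfl rfl rfl rfl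
    refine (heapCut_spec hinv (Or.inr rfl) (by simp) (by simp) hyτ hpA (by simp)).frame ?_
    rintro τ' t hfr ⟨ht, hi, -, hm⟩
    have hyw : τ'.word .y = τ.warr .parent (τ.word .y) := by
      rw [hfr.word .y rfl]; simp
    refine ⟨_, ⟨_, hyw ▸ hi, hyw ▸ hpA, ?_, rfl⟩, ?_⟩
    · rw [moved_same]; exact fun z hz => List.mem_cons_of_mem _ (hsub hz)
    · have hm' : marked n A τ' + 1 ≤ marked n A τ := by
        rw [← marked_congr (σ := τ) (σ' := (τ.setW .x (τ.word .y)).setW .y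
          (τ.warr .parent (τ.word .y))) rfl rfl]
        simpa [hb.2] using hm
      simp only [pot, moved_same, List.length_cons, test_steps_and, test_steps_not, test_steps_eq,
        steps_at, steps_var, steps_null, steps_lit]
      omega
  · rintro τ t ⟨k, ⟨ch', hτ, hyτ, hsub, rfl⟩, hb, ht⟩
    simp only [test_steps_and, test_steps_not, test_steps_eq, steps_at, steps_var, steps_null,
      steps_lit] at ht
    simp only [holds_and, holds_not, holds_eq, eval_at, eval_var, eval_null, eval_lit, hτ.n_eq]
      at hb
    have hyn : τ.word .y ≠ n := fun e => hτ.forest.notMem (e ▸ hyτ)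
    refine wp_ite (fun hr => ?_) (fun hr => ?_)
    · simp only [holds_eq, eval_at, eval_var, eval_null, hτ.n_eq] at hr
      simp only [wp_skip]
      refine ⟨ch', ⟨hτ.n_eq, hτ.forest, hτ.deg, fun z hz => (hτ.fib z hz).mono fun c hc => ?_⟩,
        hsub, ?_⟩
      -- A root lies in no list of children, so the exception can be dropped.
      · obtain ⟨hcA, hcp⟩ := (hτ.forest.mem z (by simp [hz]) c).1 hc
        have : c ≠ τ.word .y := by
          rintro rfl; exact hτ.forest.notMem (hr ▸ hcp ▸ hz)
        simp [linkRank, this]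
      · simp only [test_steps_eq, steps_at, steps_var, steps_null]
        omega
    · simp only [holds_eq, eval_at, eval_var, eval_null, hτ.n_eq] at hr
      have hm : τ.warr .mark (τ.word .y) ≠ 1 := by tauto
      simp only [wp_putW]
      refine ⟨ch', ⟨by simp [hτ.n_eq], hτ.forest.congr (by simp) (by simp) (by simp),
        by simpa using hτ.deg, fun z hz => (hτ.fib z hz).mono fun c hc => ?_⟩, hsub, ?_⟩
      -- The fresh mark on `y` replaces the allowance for `c = d`, so `linkRank` keeps its value.
      · simp only [linkRank, eval_var, eval_lit, putW_warr, if_true, update_apply]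
        by_cases e : c = τ.word .y
        · subst e; simp [hm]
        · simp [e]
      · have hmk : marked n A (τ.putW .mark (τ.word .y) 1) ≤ marked n A τ + 1 := by
          unfold marked
          refine le_trans (Finset.card_le_card ?_) (Finset.card_insert_le (τ.word .y) _)
          intro z hz
          by_cases e : z = τ.word .y
          · simp [e]
          · simp_all
        simp only [test_steps_eq, steps_at, steps_var, steps_null, steps_lit, eval_var, eval_lit,
          pot] at ht ⊢
        omega

/-- The new root `v` binds 300 and the cascade accounts for 600; the rest of 1500 covers the code
without loops. -/
theorem heapDecreaseKey_spec (h : HeapInv n A ch n n σ) (hv : σ.word .v ∈ A)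
    (hmin : MinOk n ch σ) :
    wp heapDecreaseKey (fun σ' t => ∃ ch', HeapInv n A ch' n n σ' ∧ MinOk n ch' σ' ∧
      t + pot n A ch' σ' ≤ 1500 + pot n A ch σ) σ := by
  set v := σ.word .v with hvdef
  have hvn : v ≠ n := fun e => h.forest.notMem (e ▸ hv)
  -- The last instruction, shared by all branches. The case of a null minimum with `v` a root covers
  -- a forest that had no roots before the cut, which the invariant does not exclude as it has no
  -- acyclicity clause.
  have hfin : ∀ (τ : State) (ch' : ℕ → List ℕ) (k : ℕ), HeapInv n A ch' n n τ → τ.word .v = v →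
      (τ.word .min = n ∧ v ∈ ch' n ∨ MinOk n ch' τ) → k + pot n A ch' τ ≤ 1400 + pot n A ch σ →
      wp (.ite (.eq (WArr.parent.at .v) null) (updateMin .v) .skip)
        (fun σ' t => ∃ ch', HeapInv n A ch' n n σ' ∧ MinOk n ch' σ' ∧
          k + t + pot n A ch' σ' ≤ 1500 + pot n A ch σ) τ := by
    intro τ ch' k hi hvτ hm hk
    refine wp_ite (fun hr => wp_updateMin fun m t hm' ht => ?_) (fun hr => ?_)
    · simp only [holds_eq, eval_at, eval_var, eval_null, hi.n_eq, hvτ] at hr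
      have hroot : v ∈ ch' n := hi.forest.mem_root.2 ⟨hv, hr⟩
      refine ⟨ch', hi.congr (by simp) rfl rfl rfl rfl rfl, Or.inr ?_, ?_⟩
      · simp only [setW_word, if_true]
        rcases hm' with rfl | ⟨rfl, hne⟩
        · rwa [hvτ]
        · rcases hm with ⟨e, _⟩ | ⟨e, _⟩ | hm
          · exact absurd (e.trans hi.n_eq.symm) hne
          · exact absurd (e.trans hi.n_eq.symm) hne
          · exact hm
      · have : pot n A ch' (τ.setW .min m) = pot n A ch' τ := rfl
        simp only [test_steps_eq, steps_at, steps_var, steps_null]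
        omega
    · simp only [holds_eq, eval_at, eval_var, eval_null, hi.n_eq, hvτ] at hr
      simp only [wp_skip]
      refine ⟨ch', hi, hm.resolve_left fun e => hr (hi.forest.mem_root.1 e.2).2, ?_⟩
      simp only [test_steps_eq, steps_at, steps_var, steps_null]
      omega
  simp only [heapDecreaseKey, wp_block_cons, wp_block_nil, wp_putR, wp_setW]
  set τ := ((σ.putR .key ((WExpr.var .v).eval σ) ((RExpr.var .c).eval σ)).setW .y
    ((WArr.parent.at .v).eval (σ.putR .key ((WExpr.var .v).eval σ) ((RExpr.var .c).eval σ))))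
    with hτdef
  have hτ : HeapInv n A ch n n τ := h.congr (by simp [τ]) rfl rfl rfl rfl rfl
  have hτm : MinOk n ch τ := by simpa [MinOk, τ] using hmin
  have hτv : τ.word .v = v := by simp [τ, v]
  have hτy : τ.word .y = σ.warr .parent v := by simp [τ, v]
  have hτp : τ.warr .parent = σ.warr .parent := rfl
  have hpot : pot n A ch τ = pot n A ch σ := rfl
  simp only [add_assoc, add_zero]
  have hskip : ∀ k, k ≤ 100 → wp (.ite (.eq (WArr.parent.at .v) null) (updateMin .v) .skip)
      (fun σ' t => ∃ ch', HeapInv n A ch' n n σ' ∧ MinOk n ch' σ' ∧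
        k + t + pot n A ch' σ' ≤ 1500 + pot n A ch σ) τ :=
    fun k hk => hfin τ ch k hτ hτv (Or.inr hτm) (by omega)
  refine wp_ite (fun _ => ?_) (fun hyn => wp_ite (fun _ => ?_) (fun _ => ?_))
  · simp only [wp_skip]
    refine (hskip 100 le_rfl).mono ?_
    rintro σ' t ⟨ch', a, b, c⟩
    refine ⟨ch', a, b, ?_⟩
    simp only [test_steps_eq, rsteps_var, steps_at, steps_var,
      steps_null]
    omega
  · simp only [holds_eq, eval_var, eval_null, hτ.n_eq, hτy] at hyn
    have hpA : σ.warr .parent v ∈ A := by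
      have := h.forest.par_mem v hv
      simp only [Finset.mem_insert, hyn, false_or] at this
      exact this
    simp only [wp_block_cons, wp_block_nil, wp_setW]
    have hi₁ : HeapInv n A ch n n (τ.setW .x ((WExpr.var .v).eval τ)) :=
      hτ.congr (by simp) rfl rfl rfl rfl rfl
    refine (heapCut_spec hi₁ (Or.inl rfl) (by simp [hτv]) (by simpa using hτy) hv hpA
      (by simp [hτp])).frame ?_
    rintro τ₁ t₁ hf₁ ⟨ht₁, hi₂, -, hm₁⟩
    refine (heapCascadingCut_spec hi₂ ((hf₁.word .y rfl).trans (by simpa using hτy)) hpA).frame ?_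
    rintro τ₂ t₂ hf₂ ⟨ch', hi₃, hsub, ht₂⟩
    have hm₂ : τ₂.word .min = n ∧ v ∈ ch' n ∨ MinOk n ch' τ₂ := by
      have hmw : τ₂.word .min = σ.word .min := by
        rw [hf₂.word .min rfl, hf₁.word .min rfl]; simp [τ]
      rw [moved_same] at hsub
      rw [MinOk, hmw]
      rcases hmin with ⟨e, _⟩ | hmin
      · exact Or.inl ⟨e, hsub (by simp)⟩
      · exact Or.inr (Or.inr (hsub (List.mem_cons_of_mem _ hmin)))
    have hv₂ : τ₂.word .v = v := by
      rw [hf₂.word .v rfl, hf₁.word .v rfl]; simp [hτv]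
    have hpm : pot n A (moved ch v (σ.warr .parent v) n) τ₁ ≤ 300 + pot n A ch σ := by
      have : marked n A τ₁ ≤ marked n A σ := by
        have : marked n A (τ.setW .x ((WExpr.var .v).eval τ)) = marked n A σ := rfl
        omega
      simp only [pot, moved_same, List.length_cons]; omega
    have := hfin τ₂ ch' (100 + t₁ + t₂) hi₃ hv₂ hm₂ (by omega)
    refine this.mono ?_
    rintro σ' t ⟨ch'', a, b, c⟩
    refine ⟨ch'', a, b, ?_⟩
    simp only [test_steps_eq, test_steps_rlt, rsteps_at, rsteps_var, steps_at, steps_var,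
      steps_null]
    omega
  · simp only [wp_skip]
    refine (hskip 100 le_rfl).mono ?_
    rintro σ' t ⟨ch', a, b, c⟩
    refine ⟨ch', a, b, ?_⟩
    simp only [test_steps_eq, test_steps_rlt, rsteps_at, rsteps_var, steps_at, steps_var,
      steps_null]
    omega
end

/-! ### Insertion and linking. -/

section
variable {n : ℕ} {A : Finset ℕ} {ch : ℕ → List ℕ} {σ : State}

theorem heapInsert_spec (h : HeapInv n A ch n n σ) (hv : σ.word .v < n) (hvA : σ.word .v ∉ A)
    (hmin : MinOk n ch σ) :
    wp heapInsert (fun σ' t => ∃ ch', HeapInv n (insert (σ.word .v) A) ch' n n σ' ∧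
      MinOk n ch' σ' ∧ t + pot n (insert (σ.word .v) A) ch' σ' ≤ 500 + pot n A ch σ) σ := by
  set v := σ.word .v with hvdef
  have hf := h.forest.insertRoot hv hvA
  set ch' := update (update ch v []) n (v :: ch n) with hch'
  have hn : ch' n = v :: ch n := by simp [ch']
  have hne : ∀ z ∈ A, ch' z = ch z := by
    intro z hz
    have h₁ : z ≠ n := fun e => h.forest.notMem (e ▸ hz)
    have h₂ : z ≠ v := fun e => hvA (e ▸ hz)
    simp [ch', h₁, h₂]
  have hchv : ch' v = [] := by simp [ch', hv.ne]
  simp only [heapInsert, wp_block_cons, wp_block_nil, wp_putW, wp_listInsert_null]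
  refine wp_updateMin fun k t hk ht => ?_
  refine ⟨ch', ⟨by simp [h.n_eq], ?_, ?_, ?_⟩, ?_, ?_⟩
  · refine hf.congr ?_ ?_ ?_ <;> simp [h.n_eq, ← hvdef]
  · intro z hz hzn
    rcases Finset.mem_insert.1 hz with rfl | hz
    · simp [← hvdef, hchv]
    · have h₂ : z ≠ v := fun e => hvA (e ▸ hz)
      simp [← hvdef, h₂, hne z hz, h.deg z hz hzn]
  · intro z hz
    rcases Finset.mem_insert.1 hz with rfl | hz
    · rw [hchv]; trivial
    · rw [hne z hz]
      refine (h.fib z hz).mono fun c hc => ?_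
      have hcA : c ∈ A := ((h.forest.mem z (by simp [hz]) c).1 hc).1
      have h₂ : c ≠ v := fun e => hvA (e ▸ hcA)
      simp [linkRank, hne c hcA, ← hvdef, h₂]
  · right
    rw [hn]
    simp only [setW_word, if_true]
    rcases hk with rfl | ⟨rfl, hk⟩
    · simp [← hvdef]
    · simp only [attach_word, putW_word, h.n_eq] at hk ⊢
      rcases hmin with ⟨e, _⟩ | hm
      · exact absurd e hk
      · exact List.mem_cons_of_mem _ hm
  · have hm : ∀ τ : State, τ.warr .parent = update (σ.warr .parent) v n →
        τ.warr .mark = update (σ.warr .mark) v 0 → marked n (insert v A) τ ≤ marked n A σ := by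
      intro τ h₁ h₂
      refine Finset.card_le_card fun z hz => ?_
      by_cases e : z = v <;> simp_all
    have : ∀ τ : State, τ.warr .parent = update (σ.warr .parent) v n →
        τ.warr .mark = update (σ.warr .mark) v 0 →
        pot n (insert v A) ch' τ ≤ 300 + pot n A ch σ := by
      intro τ h₁ h₂
      have := hm τ h₁ h₂
      simp only [pot, hn, List.length_cons]
      omega
    refine le_trans (Nat.add_le_add_left (this _ ?_ ?_) _) ?_
    · simp [h.n_eq, ← hvdef]
    · simp [← hvdef]
    · simp only [steps_sentinel, steps_var, steps_null, steps_lit]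
      omega

/-- Equality of the degrees is what creates the rank condition: `y` joins a list whose length is its
own number of children. The clearing of its mark keeps the new non-root out of the potential. -/
theorem heapLink_spec {x y : ℕ} (h : HeapInv n A ch n n σ) (hxw : σ.word .x = x)
    (hyw : σ.word .y = y) (hx : x ∈ ch n) (hy : y ∈ ch n) (hxy : x ≠ y)
    (hlen : (ch x).length = (ch y).length) :
    wp heapLink (fun σ' t => t ≤ 100 ∧ HeapInv n A (moved ch y n x) n n σ' ∧
      marked n A σ' ≤ marked n A σ) σ := by
  obtain ⟨hxA, hxp⟩ := h.forest.mem_root.1 hx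
  obtain ⟨hyA, hyp⟩ := h.forest.mem_root.1 hy
  have hxn : x ≠ n := fun e => h.forest.notMem (e ▸ hxA)
  have hf := h.forest.move hyA hyp (o' := x) (by simp [hxA]) hxn.symm
  have hch : ∀ z ∈ A, z ≠ x → moved ch y n x z = ch z := by
    intro z hz hzx
    have hzn : z ≠ n := fun e => h.forest.notMem (e ▸ hz)
    rw [moved, update_of_ne hzx, update_of_ne hzn]
  simp only [heapLink, wp_block_cons, wp_block_nil, wp_listRemove, wp_listInsert_sentinel, wp_putW]
  refine ⟨by simp, ⟨by simp [h.n_eq], ?_, ?_, ?_⟩, ?_⟩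
  · refine hf.congr ?_ ?_ ?_ <;> simp [hxw, hyw, h.n_eq, cell, hxn]
  · intro z hz hzn
    have h₁ := h.deg z hz hzn
    by_cases e : z = x
    · subst e; simp [hxw, h₁, moved_same]
    · simp [hxw, e, h₁, hch z hz e]
  · have key : ∀ z ∈ A, ∀ c ∈ ch z, linkRank ch (σ.warr .mark) n c ≤
        linkRank (moved ch y n x) (update (σ.warr .mark) y 0) n c := by
      intro z hz c hc
      have hzn : z ≠ n := fun e => h.forest.notMem (e ▸ hz)
      obtain ⟨hcA, hcp⟩ := (h.forest.mem z (by simp [hz]) c).1 hc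
      have hcy : c ≠ y := by rintro rfl; exact hzn (hcp ▸ hyp)
      have hcx : c ≠ x := by rintro rfl; exact hzn (hcp ▸ hxp)
      simp [linkRank, hcy, hch c hcA hcx]
    intro z hz
    have hmk : ∀ τ : State, τ.warr .mark = update (σ.warr .mark) y 0 →
        Fib (linkRank (moved ch y n x) (τ.warr .mark) n) (moved ch y n x z) := by
      intro τ hτ
      rw [hτ]
      by_cases e : z = x
      · subst e
        rw [moved_same]
        refine ⟨?_, (h.fib z hz).mono (key z hz)⟩
        simp [linkRank, hch y hyA hxy.symm, hlen]
      · rw [hch z hz e]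
        exact (h.fib z hz).mono (key z hz)
    apply hmk
    simp [hyw]
  · refine Finset.card_le_card fun z hz => ?_
    by_cases e : z = y
    · simp_all
    · simp_all

/-! ### Consolidation -/

/-- The default of `headD` is the cell where the segment ends. In the list of roots this is the null
pointer, so an exhausted list reads as null. -/
theorem Seg.next_eq {nx pv : ℕ → ℕ} {l : List ℕ} {a b : ℕ} (h : Seg nx pv a l b) :
    nx a = l.headD b := by
  cases l with
  | nil => exact h.1
  | cons c l => exact h.1

theorem Forest.next_sentinel (h : Forest n A ch σ) {o : ℕ} (ho : o ∈ insert n A) :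
    σ.warr .next (cell n o) = (ch o).headD (cell n o) := (h.lists.seg o ho).next_eq

theorem Forest.next_root (h : Forest n A ch σ) {l l' : List ℕ} {x : ℕ}
    (hl : ch n = l ++ x :: l') : σ.warr .next x = l'.headD n := by
  have := h.lists.seg n (by simp)
  rw [hl] at this
  simpa [cell] using (Seg.append.1 this).2.next_eq

/-- The buckets `0, …, n - 1` hold exactly the items with the property `P`, each at its degree. -/
def Buckets (n : ℕ) (ch : ℕ → List ℕ) (P : ℕ → Prop) (σ : State) : Prop :=
  ∀ d < n, ∀ z ≠ n, σ.warr .bucket d = z ↔ P z ∧ (ch z).length = d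

theorem Buckets.iff {P P' : ℕ → Prop} (h : Buckets n ch P σ) (hP : ∀ z, P z ↔ P' z) :
    Buckets n ch P' σ := fun d hd z hz => (h d hd z hz).trans (by rw [hP])

/-- All buckets are null. -/
def BucketsNull (n : ℕ) (σ : State) : Prop := ∀ d < n, σ.warr .bucket d = n

theorem buckets_false : Buckets n ch (fun _ => False) σ ↔ BucketsNull n σ := by
  constructor
  · intro h d hd; by_contra e; exact ((h d hd _ e).1 rfl).1
  · intro h d hd z hz; rw [h d hd]; exact iff_of_false hz.symm (fun h => h.1)

theorem HeapInv.deg_root {d : ℕ} (h : HeapInv n A ch d n σ) {x : ℕ} (hx : x ∈ ch n) :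
    σ.warr .degree x = (ch x).length := by
  have hxA := (h.forest.mem_root.1 hx).1
  exact h.deg x hxA fun e => h.forest.notMem (e ▸ hxA)

theorem HeapInv.root_lt {d ex : ℕ} (h : HeapInv n A ch d ex σ) {x : ℕ} (hx : x ∈ ch n) : x < n :=
  h.forest.lt (h.forest.mem_root.1 hx).1

theorem HeapInv.nodup_roots {d ex : ℕ} (h : HeapInv n A ch d ex σ) : (ch n).Nodup :=
  h.forest.lists.nodup n (by simp)

/-- Among the roots, only `x` gains children and only `y` disappears. Both are out of the buckets,
so all bucket entries stay correct. -/
theorem heapLink_buckets {x y : ℕ} {done rest : List ℕ} (h : HeapInv n A ch n n σ)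
    (hxw : σ.word .x = x) (hyw : σ.word .y = y) (hr : ch n = done ++ rest)
    (hx : x ∈ done) (hy : y ∈ done) (hxy : x ≠ y) (hlen : (ch x).length = (ch y).length)
    (hb : Buckets n ch (fun z => z ∈ done ∧ z ≠ x ∧ z ≠ y) σ) :
    wp heapLink (fun σ' t => t ≤ 100 ∧ ∃ ch' done', HeapInv n A ch' n n σ' ∧
      ch' n = done' ++ rest ∧ done'.length + 1 = done.length ∧ x ∈ done' ∧
      Buckets n ch' (fun z => z ∈ done' ∧ z ≠ x) σ' ∧ marked n A σ' ≤ marked n A σ) σ := by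
  have hxr : x ∈ ch n := by simp [hr, hx]
  have hyr : y ∈ ch n := by simp [hr, hy]
  have hxn := (h.root_lt hxr).ne
  have hnd : done.Nodup := by
    have := h.nodup_roots; rw [hr] at this; exact (List.nodup_append.1 this).1
  refine (heapLink_spec h hxw hyw hxr hyr hxy hlen).frame ?_
  rintro σ' t hfr ⟨ht, hi, hm⟩
  refine ⟨ht, _, done.erase y, hi, ?_, ?_, ?_, ?_, hm⟩
  · rw [moved, update_of_ne hxn.symm, update_self, hr, List.erase_append_left _ hy]
  · have := List.length_pos_of_mem hy
    rw [List.length_erase_of_mem hy]; omega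
  · exact (List.mem_erase_of_ne hxy).2 hx
  · intro d hd z hz
    rw [hfr.warr .bucket rfl, hb d hd z hz]
    simp only [hnd.mem_erase_iff]
    constructor
    · rintro ⟨⟨h₁, h₂, h₃⟩, h₄⟩
      exact ⟨⟨⟨h₃, h₁⟩, h₂⟩, by rwa [moved, update_of_ne h₂, update_of_ne hz]⟩
    · rintro ⟨⟨⟨h₃, h₁⟩, h₂⟩, h₄⟩
      exact ⟨⟨h₁, h₂, h₃⟩, by rwa [moved, update_of_ne h₂, update_of_ne hz] at h₄⟩

/-- The inner loop of the consolidation, which links `x` with the roots in the buckets. -/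
theorem linkLoop_spec {done rest : List ℕ} {m : ℕ} (h : HeapInv n A ch n n σ)
    (hr : ch n = done ++ rest) (hx : σ.word .x ∈ done) (hm : marked n A σ ≤ m)
    (hb : Buckets n ch (fun z => z ∈ done ∧ z ≠ σ.word .x) σ) :
    wp (.loop (.not (.eq (WArr.bucket.at (WArr.degree.at .x)) null)) (block [
      .setW .y (WArr.bucket.at (WArr.degree.at .x)),
      .putW .bucket (WArr.degree.at .x) null,
      .ite (.rlt (RArr.key.at .y) (RArr.key.at .x))
        (block [.setW .z .x, .setW .x .y, .setW .y .z])
        .skip,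
      heapLink]))
      (fun σ' t => ∃ ch' done', HeapInv n A ch' n n σ' ∧ ch' n = done' ++ rest ∧
        σ'.word .x ∈ done' ∧ marked n A σ' ≤ m ∧
        Buckets n ch' (fun z => z ∈ done' ∧ z ≠ σ'.word .x) σ' ∧
        σ'.warr .bucket (σ'.warr .degree (σ'.word .x)) = n ∧
        t + 200 * (ch' n).length ≤ 10 + 200 * (ch n).length) σ := by
  -- Every link removes one root, so 200 per root pays for all iterations. Links take roots from
  -- `done'` only and leave `rest` as it is.
  refine (wp_loop (fun τ k => ∃ ch' done', HeapInv n A ch' n n τ ∧ ch' n = done' ++ rest ∧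
        τ.word .x ∈ done' ∧ marked n A τ ≤ m ∧
        Buckets n ch' (fun z => z ∈ done' ∧ z ≠ τ.word .x) τ ∧ k = 200 * (ch' n).length)
        ?_ _ _ ⟨ch, done, h, hr, hx, hm, hb, rfl⟩).mono ?_
  · rintro τ k ⟨ch₁, done₁, hi, hr₁, hx₁, hm₁, hb₁, rfl⟩ hne
    have hxr : τ.word .x ∈ ch₁ n := by simp [hr₁, hx₁]
    have hdeg := hi.deg_root hxr
    have hlt := hi.length_lt hxr
    set x := τ.word .x with hxdef
    simp only [holds_not, holds_eq, eval_at, eval_var, eval_null, hi.n_eq, hdeg, ← hxdef] at hne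
    set y := τ.warr .bucket (ch₁ x).length with hydef
    obtain ⟨⟨hy₁, hyx⟩, hylen⟩ := (hb₁ _ hlt y hne).1 rfl
    have hyn : y ≠ n := hne
    simp only [wp_block_cons, wp_block_nil, wp_setW, wp_putW]
    set τ₁ := (τ.setW .y ((WArr.bucket.at (WArr.degree.at .x)).eval τ)).putW .bucket
      ((WArr.degree.at .x).eval (τ.setW .y ((WArr.bucket.at (WArr.degree.at .x)).eval τ)))
      (null.eval (τ.setW .y ((WArr.bucket.at (WArr.degree.at .x)).eval τ))) with hτ₁
    have hbk : τ₁.warr .bucket = update (τ.warr .bucket) (ch₁ x).length n := by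
      simp [τ₁, hi.n_eq, hdeg, ← hxdef]
    have hi₁ : HeapInv n A ch₁ n n τ₁ := by
      refine hi.congr ?_ ?_ ?_ ?_ ?_ ?_ <;> simp [τ₁]
    have hm₂ : marked n A τ₁ = marked n A τ := by
      apply marked_congr <;> simp [τ₁]
    have hτx : τ₁.word .x = x := by simp [τ₁, ← hxdef]
    have hτy : τ₁.word .y = y := by simp [τ₁, ← hxdef, hdeg, ← hydef]
    have hb₂ : Buckets n ch₁ (fun z => z ∈ done₁ ∧ z ≠ x ∧ z ≠ y) τ₁ := by
      intro d hd z hz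
      rw [hbk]
      by_cases e : d = (ch₁ x).length
      · subst e
        rw [update_self]
        refine iff_of_false hz.symm ?_
        rintro ⟨⟨h₁, h₂, h₃⟩, h₄⟩
        exact h₃ ((hb₁ _ hd z hz).2 ⟨⟨h₁, h₂⟩, h₄⟩).symm
      · rw [update_of_ne e, hb₁ d hd z hz]
        constructor
        · rintro ⟨⟨h₁, h₂⟩, h₃⟩
          exact ⟨⟨h₁, h₂, fun e' => e (by rw [← h₃, e', hylen])⟩, h₃⟩
        · rintro ⟨⟨h₁, h₂, _⟩, h₃⟩; exact ⟨⟨h₁, h₂⟩, h₃⟩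
    refine wp_ite (fun _ => ?_) (fun _ => ?_)
    · simp only [wp_block_cons, wp_block_nil, wp_setW]
      -- After the swap the same link happens with the roles of `x` and `y` exchanged; the bucket
      -- condition is symmetric in them.
      refine (heapLink_buckets (x := y) (y := x) (done := done₁) (rest := rest)
        (hi₁.congr ?_ ?_ ?_ ?_ ?_ ?_) ?_ ?_ hr₁ hy₁ hx₁ hyx hylen ?_).frame ?_
      · simp
      · rfl
      · rfl
      · rfl
      · rfl
      · rfl
      · simp [hτy]
      · simp [hτx]
      · exact hb₂.iff fun z => by tauto
      · rintro τ' t hfr ⟨ht, ch', done', hi', hr', hl', hx', hb', hm'⟩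
        have e : τ'.word .x = y := by rw [hfr.word .x rfl]; simp [hτy]
        refine ⟨_, ⟨ch', done', hi', hr', e ▸ hx', ?_, e ▸ hb', rfl⟩, ?_⟩
        · exact hm'.trans (hm₂.le.trans hm₁)
        · simp only [test_steps_not, test_steps_eq, test_steps_rlt, rsteps_at, steps_at, steps_var,
            steps_null, hr', hr₁, List.length_append]
          omega
    · simp only [wp_skip]
      refine (heapLink_buckets (done := done₁) (rest := rest)
        hi₁ hτx hτy hr₁ hx₁ hy₁ hyx.symm hylen.symm hb₂).frame ?_
      rintro τ' t hfr ⟨ht, ch', done', hi', hr', hl', hx', hb', hm'⟩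
      have e : τ'.word .x = x := by rw [hfr.word .x rfl, hτx]
      refine ⟨_, ⟨ch', done', hi', hr', e ▸ hx', ?_, e ▸ hb', rfl⟩, ?_⟩
      · exact hm'.trans (hm₂.le.trans hm₁)
      · simp only [test_steps_not, test_steps_eq, test_steps_rlt, rsteps_at, steps_at, steps_var,
          steps_null, hr', hr₁, List.length_append]
        omega
  · rintro τ t ⟨k, ⟨ch', done', hi, hr', hx', hm', hb', rfl⟩, hne, ht⟩
    refine ⟨ch', done', hi, hr', hx', hm', hb', ?_, ?_⟩
    · simpa [hi.n_eq] using hne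
    · simp only [test_steps_not, test_steps_eq, steps_at, steps_var, steps_null] at ht
      omega

/-- The number of roots when their degrees are pairwise different. -/
theorem HeapInv.length_roots_le {P : ℕ → Prop} (h : HeapInv n A ch n n σ)
    (hb : Buckets n ch P σ) (hP : ∀ z ∈ ch n, P z) :
    (ch n).length ≤ 2 * Nat.log 2 n + 2 := by
  rw [← List.toFinset_card_of_nodup h.nodup_roots,
    ← Finset.card_range (2 * Nat.log 2 n + 2)]
  -- A bucket holds a single value, so roots in buckets have different degrees. By `degree_le` these
  -- take at most 2 log n + 2 values.
  refine Finset.card_le_card_of_injOn (fun z => (ch z).length) ?_ ?_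
  · intro z hz
    have := h.degree_le (List.mem_toFinset.1 hz)
    simp only [Finset.coe_range, Set.mem_Iio]
    omega
  · intro z hz z' hz' e
    have hz := List.mem_toFinset.1 (Finset.mem_coe.1 hz)
    have hz' := List.mem_toFinset.1 (Finset.mem_coe.1 hz')
    have h₁ := (hb _ (h.length_lt hz) z (h.root_lt hz).ne).2 ⟨hP z hz, rfl⟩
    have h₂ := (hb _ (h.length_lt hz') z' (h.root_lt hz').ne).2 ⟨hP z' hz', rfl⟩
    simp only at e
    rw [← h₁, ← h₂, e]

theorem headD_eq_null {d ex : ℕ} {l l' : List ℕ} (h : HeapInv n A ch d ex σ)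
    (hr : ch n = l ++ l') (e : l'.headD n = n) : l' = [] := by
  cases l' with
  | nil => rfl
  | cons c l' =>
    simp only [List.headD_cons] at e
    exact absurd e (h.root_lt (by simp [hr])).ne

theorem exists_cons_of_headD {l : List ℕ} (e : l.headD n ≠ n) : ∃ c l', l = c :: l' := by
  cases l with
  | nil => simp at e
  | cons c l => exact ⟨c, l, rfl⟩

theorem heapConsolidate_spec (h : HeapInv n A ch n n σ) (hb : BucketsNull n σ) :
    wp heapConsolidate (fun σ' t => ∃ ch', HeapInv n A ch' n n σ' ∧ MinOk n ch' σ' ∧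
      BucketsNull n σ' ∧ marked n A σ' ≤ marked n A σ ∧
      (ch' n).length ≤ 2 * Nat.log 2 n + 2 ∧
      t ≤ 300 * (ch n).length + 200 * Nat.log 2 n + 300) σ := by
  have hhead : ∀ {τ : State} {ch₁ : ℕ → List ℕ}, HeapInv n A ch₁ n n τ →
      τ.warr .next n = (ch₁ n).headD n := fun hi => by
    simpa [cell] using hi.forest.next_sentinel (o := n) (by simp)
  simp only [heapConsolidate, wp_block_cons, wp_block_nil, wp_setW]
  -- A root brings 300: 100 for its turn in this loop and 200 for the link that may remove it. Links
  -- spare `rest`, so the saved pointer `r` stays valid.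
  refine (wp_loop (fun τ k => ∃ ch₁ done rest, HeapInv n A ch₁ n n τ ∧ ch₁ n = done ++ rest ∧
    τ.word .r = rest.headD n ∧ Buckets n ch₁ (· ∈ done) τ ∧ marked n A τ ≤ marked n A σ ∧
    k = 100 * rest.length + 200 * (ch₁ n).length) ?_ (300 * (ch n).length) _ ?_).mono ?_
  · rintro τ k ⟨ch₁, done, rest, hi, hr, hrw, hbk, hm, rfl⟩ hne
    simp only [holds_not, holds_eq, eval_var, eval_null, hi.n_eq, hrw] at hne
    obtain ⟨x, rest, rfl⟩ := exists_cons_of_headD hne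
    simp only [List.headD_cons] at hrw
    have hnd := hi.nodup_roots
    have hxr : x ∈ ch₁ n := by simp [hr]
    have hxd : x ∉ done := by
      rw [hr, List.nodup_append] at hnd
      exact fun hx => hnd.2.2 x hx x (by simp) rfl
    simp only [wp_block_cons, wp_block_nil, wp_setW]
    set τ₁ := (τ.setW .x ((WExpr.var .r).eval τ)).setW .r
      ((WArr.next.at .r).eval (τ.setW .x ((WExpr.var .r).eval τ))) with hτ₁
    have hx₁ : τ₁.word .x = x := by simp [τ₁, hrw]
    have hr₁ : τ₁.word .r = rest.headD n := by
      simp [τ₁, hrw, hi.forest.next_root hr]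
    refine (linkLoop_spec (σ := τ₁) (done := done ++ [x]) (rest := rest) (m := marked n A σ)
      (hi.congr (by simp [τ₁]) rfl rfl rfl rfl rfl) (by simp [hr]) (by simp [hx₁]) hm ?_).frame ?_
    · rw [hx₁]
      refine Buckets.iff hbk fun z => ?_
      by_cases e : z = x
      · subst e; simp [hxd]
      · simp [e]
    · rintro τ₂ t₂ hfr ⟨ch₂, done₂, hi₂, hr₂, hx₂, hm₂, hb₂, hbn, ht₂⟩
      have hxr₂ : τ₂.word .x ∈ ch₂ n := by simp [hr₂, hx₂]
      simp only [wp_putW]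
      rw [hi₂.deg_root hxr₂] at hbn
      refine ⟨_, ⟨ch₂, done₂, rest, ?_, hr₂, ?_, ?_, ?_, rfl⟩, ?_⟩
      · refine hi₂.congr ?_ ?_ ?_ ?_ ?_ ?_ <;> simp
      · rw [putW_word, hfr.word .r rfl, hr₁]
      · intro d hd z hz
        simp only [putW_warr, if_true, eval_at, eval_var, hi₂.deg_root hxr₂]
        by_cases e : d = (ch₂ (τ₂.word .x)).length
        · subst e
          rw [update_self]
          constructor
          · rintro rfl; exact ⟨hx₂, rfl⟩
          · rintro ⟨h₁, h₂⟩
            by_contra e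
            -- Another processed root of this degree would occupy the bucket that the inner loop
            -- found empty.
            have := (hb₂ _ hd z hz).2 ⟨⟨h₁, fun h => e h.symm⟩, h₂⟩
            exact hz (this.symm.trans hbn)
        · rw [update_of_ne e, hb₂ d hd z hz]
          constructor
          · rintro ⟨⟨h₁, _⟩, h₂⟩; exact ⟨h₁, h₂⟩
          · rintro ⟨h₁, h₂⟩
            exact ⟨⟨h₁, fun e' => e (by rw [← h₂, e'])⟩, h₂⟩
      · rw [marked_congr (σ := τ₂)]
        · exact hm₂
        · simp
        · simp
      · simp only [test_steps_not, test_steps_eq, steps_at, steps_var, steps_null,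
          List.length_cons]
        omega
  · refine ⟨ch, [], ch n, h.congr (by simp) rfl rfl rfl rfl rfl, rfl, ?_, ?_, le_rfl, by omega⟩
    · simp [h.n_eq, hhead h]
    · exact Buckets.iff (P := fun _ => False) (buckets_false.2 hb) (by simp)
  · rintro τ t ⟨k, ⟨ch₁, done, rest, hi, hr, hrw, hbk, hm, rfl⟩, hne, ht⟩
    simp only [holds_not, holds_eq, eval_var, eval_null, hi.n_eq, hrw, not_not] at hne
    obtain rfl := headD_eq_null hi hr hne
    rw [List.append_nil] at hr
    subst hr
    have hroots := hi.length_roots_le hbk fun z hz => hz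
    simp only [test_steps_not, test_steps_eq, steps_var, steps_null] at ht
    -- Only O(log n) roots are left, so this pass needs no potential. The buckets still in use are
    -- those of `rest`; at the end all are null.
    refine (wp_loop (fun τ' k => ∃ done rest, HeapInv n A ch₁ n n τ' ∧ ch₁ n = done ++ rest ∧
      τ'.word .r = rest.headD n ∧ Buckets n ch₁ (· ∈ rest) τ' ∧
      marked n A τ' ≤ marked n A σ ∧
      (done = [] ∧ τ'.word .min = n ∨ τ'.word .min ∈ done) ∧
      k = 100 * rest.length) ?_ (100 * (ch₁ n).length) _ ?_).mono ?_
    · rintro τ' k ⟨done, rest, hi, hr, hrw, hbk, hm, hmin, rfl⟩ hne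
      simp only [holds_not, holds_eq, eval_var, eval_null, hi.n_eq, hrw] at hne
      obtain ⟨x, rest, rfl⟩ := exists_cons_of_headD hne
      simp only [List.headD_cons] at hrw
      have hnd := hi.nodup_roots
      have hxr : x ∈ ch₁ n := by simp [hr]
      have hxd : x ∉ rest := by
        rw [hr, List.nodup_append, List.nodup_cons] at hnd
        exact hnd.2.1.1
      have hdeg := hi.deg_root hxr
      simp only [wp_block_cons, wp_block_nil, wp_putW]
      refine wp_updateMin fun mn t₁ hmn ht₁ => ?_
      simp only [wp_setW]
      refine ⟨_, ⟨done ++ [x], rest, ?_, by simp [hr], ?_, ?_, ?_, Or.inr ?_, rfl⟩, ?_⟩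
      · refine hi.congr ?_ ?_ ?_ ?_ ?_ ?_ <;> simp
      · simp [hrw, hi.forest.next_root hr]
      · intro d hd z hz
        simp only [setW_warr, putW_warr, if_true, eval_at, eval_var, hrw, hdeg, eval_null, hi.n_eq]
        by_cases e : d = (ch₁ x).length
        · subst e
          rw [update_self]
          refine iff_of_false hz.symm ?_
          rintro ⟨h₁, h₂⟩
          have e₁ := (hbk _ hd z hz).2 ⟨List.mem_cons_of_mem _ h₁, h₂⟩
          have e₂ := (hbk _ hd x (hi.root_lt hxr).ne).2 ⟨by simp, rfl⟩
          exact hxd ((e₂.symm.trans e₁) ▸ h₁)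
        · rw [update_of_ne e, hbk d hd z hz]
          simp only [List.mem_cons]
          constructor
          · rintro ⟨rfl | h₁, h₂⟩
            · exact absurd h₂.symm e
            · exact ⟨h₁, h₂⟩
          · rintro ⟨h₁, h₂⟩; exact ⟨Or.inr h₁, h₂⟩
      · rw [marked_congr (σ := τ')]
        · exact hm
        · simp
        · simp
      · simp only [putW_word, hrw, hi.n_eq] at hmn
        rcases hmn with rfl | ⟨rfl, hmn⟩
        · simp
        · rcases hmin with ⟨_, e⟩ | hmin
          · exact absurd e hmn
          · simp [hmin]
      · simp only [test_steps_not, test_steps_eq, steps_at, steps_var, steps_null,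
          List.length_cons]
        omega
    · refine ⟨[], ch₁ n, hi.congr (by simp) rfl rfl rfl rfl rfl, rfl, ?_, hbk, hm,
        Or.inl ⟨rfl, ?_⟩, rfl⟩
      · simp [hi.n_eq, hhead hi]
      · simp [hi.n_eq]
    · rintro τ' t' ⟨k, ⟨done, rest, hi, hr, hrw, hbk, hm, hmin, rfl⟩, hne, ht'⟩
      simp only [holds_not, holds_eq, eval_var, eval_null, hi.n_eq, hrw, not_not] at hne
      obtain rfl := headD_eq_null hi hr hne
      rw [List.append_nil] at hr
      subst hr
      refine ⟨ch₁, hi, ?_, ?_, hm, hroots, ?_⟩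
      · rw [MinOk]; tauto
      · exact buckets_false.1 (hbk.iff (by simp))
      · simp only [test_steps_not, test_steps_eq, steps_at, steps_var, steps_null] at ht' ⊢
        omega

/-! ### Extraction of the minimum -/

theorem heapExtractMin_spec (h : HeapInv n A ch n n σ) (hmin : MinOk n ch σ)
    (hne : σ.word .min ≠ n) (hb : BucketsNull n σ) :
    wp heapExtractMin (fun σ' t => σ'.word .u = σ.word .min ∧ σ.word .min ∈ A ∧ ∃ ch',
      HeapInv n (A.erase (σ.word .min)) ch' n n σ' ∧ MinOk n ch' σ' ∧ BucketsNull n σ' ∧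
      t + pot n (A.erase (σ.word .min)) ch' σ' ≤ 1600 * Nat.log 2 n + 2000 + pot n A ch σ) σ := by
  set u := σ.word .min with hudef
  have hu : u ∈ ch n := hmin.resolve_left fun e => hne e.1
  have hdu := h.degree_le hu
  obtain ⟨huA, hup⟩ := h.forest.mem_root.1 hu
  -- The degree field of `u` is not updated while its children leave, so `u` is exempted until it is
  -- erased.
  have hi₀ : HeapInv n A ch u u (σ.setW .u u) := by
    refine ⟨by simp [h.n_eq], h.forest.congr rfl rfl rfl, fun x hx _ => ?_, fun z hz => ?_⟩
    · exact h.deg x hx fun e => h.forest.notMem (e ▸ hx)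
    · refine (h.fib z hz).mono fun c hc => ?_
      have hcA := ((h.forest.mem z (by simp [hz]) c).1 hc).1
      have hcn : c ≠ n := fun e => h.forest.notMem (e ▸ hcA)
      simp only [linkRank, hcn, if_false, setW_warr]
      exact Nat.le_add_right _ _
  have hcu : cell n u = n + 1 + u := by simp [cell, hne]
  simp only [heapExtractMin, wp_block_cons, wp_block_nil, wp_setW]
  refine (wp_loop (fun τ k => ∃ ch₁, HeapInv n A ch₁ u u τ ∧ u ∈ ch₁ n ∧ τ.word .u = u ∧
    marked n A τ ≤ marked n A σ ∧
    (ch₁ n).length + (ch₁ u).length = (ch n).length + (ch u).length ∧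
    k = 100 * (ch₁ u).length) ?_ (100 * (ch u).length) _
    ⟨ch, hi₀, hu, by simp, le_rfl, rfl, rfl⟩).frame ?_
  · rintro τ k ⟨ch₁, hi, hu₁, huw, hm, hlen, rfl⟩ hne'
    obtain ⟨-, hup₁⟩ := hi.forest.mem_root.1 hu₁
    have hnext := hi.forest.next_sentinel (o := u) (by simp [huA])
    rw [hcu] at hnext
    simp only [holds_not, holds_eq, eval_at, eval_sentinel, hi.n_eq, huw, hnext] at hne'
    obtain ⟨x, l, hl⟩ : ∃ x l, ch₁ u = x :: l := by
      cases e : ch₁ u with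
      | nil => simp [e] at hne'
      | cons c l => exact ⟨c, l, rfl⟩
    rw [hl, List.headD_cons] at hnext
    obtain ⟨hxA, hxp⟩ := (hi.forest.mem u (by simp [huA]) x).1 (by simp [hl])
    have hf := hi.forest.move hxA hxp (o' := n) (by simp) hne
    have hchu : moved ch₁ x u n u = l := by simp [moved, hne, hl]
    have hch : ∀ z ∈ A, z ≠ u → moved ch₁ x u n z = ch₁ z := by
      intro z hz hzu
      have hzn : z ≠ n := fun e => h.forest.notMem (e ▸ hz)
      rw [moved, update_of_ne hzn, update_of_ne hzu]
    simp only [wp_block_cons, wp_block_nil, wp_setW, wp_listRemove, wp_listInsert_null, wp_putW]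
    refine ⟨_, ⟨moved ch₁ x u n, ⟨by simp [hi.n_eq], ?_, ?_, ?_⟩, ?_, by simp [huw], ?_, ?_, rfl⟩, ?_⟩
    · refine hf.congr ?_ ?_ ?_ <;> simp [hi.n_eq, huw, hnext, cell]
    · intro z hz hzu
      simp [hi.deg z hz hzu, hch z hz hzu]
    · intro z hz
      have hzn : z ≠ n := fun e => h.forest.notMem (e ▸ hz)
      have hsub : (moved ch₁ x u n z).Sublist (ch₁ z) := by
        by_cases e : z = u
        · subst e; rw [hchu, hl]; exact List.sublist_cons_self _ _
        · rw [hch z hz e]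
      refine ((hi.fib z hz).sublist hsub).mono fun c hc => ?_
      obtain ⟨hcA, hcp⟩ := (hi.forest.mem z (by simp [hz]) c).1 (hsub.subset hc)
      have hcu : c ≠ u := by rintro rfl; exact hzn (hcp ▸ hup₁)
      simp [linkRank, hch c hcA hcu]
    · rw [moved_same]; exact List.mem_cons_of_mem _ hu₁
    -- A released child may keep its mark, but as a root it is not counted.
    · refine le_trans (Finset.card_le_card fun z hz => ?_) hm
      by_cases e : z = x
      · simp [hi.n_eq, huw, hnext, e] at hz
      · simpa [hi.n_eq, huw, hnext, e] using hz
    · rw [moved_same, hchu, ← hlen, hl]; simp only [List.length_cons]; omega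
    · simp only [hchu, hl, test_steps_not, test_steps_eq, steps_at, steps_var, steps_null,
        steps_sentinel, List.length_cons]
      omega
  · rintro τ t hfr ⟨k, ⟨ch₁, hi, hu₁, huw, hm, hlen, rfl⟩, hne', ht⟩
    have hnext := hi.forest.next_sentinel (o := u) (by simp [huA])
    rw [hcu] at hnext
    simp only [holds_not, holds_eq, eval_at, eval_sentinel, hi.n_eq, huw, hnext, not_not] at hne'
    have hnil : ch₁ u = [] := by
      cases e : ch₁ u with
      | nil => rfl
      | cons c l =>
        rw [e, List.headD_cons] at hne'
        have : c < n := hi.forest.lt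
          ((hi.forest.mem u (by simp [huA]) c).1 (by simp [e])).1
        omega
    have hf := hi.forest.removeRoot hu₁ hnil
    set ch₂ := update ch₁ n ((ch₁ n).erase u) with hch₂
    have hn₂ : ch₂ n = (ch₁ n).erase u := by simp [ch₂]
    have hz₂ : ∀ z ∈ A, ch₂ z = ch₁ z := fun z hz =>
      update_of_ne (fun e : z = n => h.forest.notMem (e ▸ hz)) _ _
    have hi₂ : HeapInv n (A.erase u) ch₂ n n (τ.detach u) := by
      refine ⟨hi.n_eq, hf, fun x hx _ => ?_, fun z hz => ?_⟩
      · obtain ⟨hxu, hx⟩ := Finset.mem_erase.1 hx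
        rw [detach_degree, hz₂ x hx]; exact hi.deg x hx hxu
      · have hzA := Finset.mem_of_mem_erase hz
        have hf₂ := hf.mem z (by simp only [Finset.mem_insert, hz, or_true])
        rw [hz₂ z hzA] at hf₂ ⊢
        refine (hi.fib z hzA).mono fun c hc => ?_
        obtain ⟨hcu, hcA⟩ := Finset.mem_erase.1 ((hf₂ c).1 hc).1
        simp [linkRank, hcu, hz₂ c hcA]
    have hb₂ : BucketsNull n (τ.detach u) := by
      intro d hd
      rw [detach_bucket, hfr.warr .bucket rfl]
      exact hb d hd
    have hm₂ : marked n (A.erase u) (τ.detach u) ≤ marked n A σ := by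
      refine le_trans (Finset.card_le_card fun z hz => ?_) hm
      simp only [Finset.mem_filter, detach_parent, detach_mark, Finset.mem_erase] at hz ⊢
      exact ⟨hz.1.2, hz.2⟩
    have hl₂ : (ch₂ n).length + 1 = (ch n).length + (ch u).length := by
      have := List.length_pos_of_mem hu₁
      rw [hn₂, List.length_erase_of_mem hu₁, ← hlen, hnil, List.length_nil]; omega
    simp only [wp_listRemove, huw]
    refine (heapConsolidate_spec hi₂ hb₂).frame ?_
    rintro τ' t' hfr' ⟨ch', hi', hmin', hb', hm', hroots, ht'⟩
    refine ⟨?_, huA, ch', hi', hmin', hb', ?_⟩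
    · rw [hfr'.word .u rfl]; exact huw
    -- With deg u ≤ 2 log n + 1, the multiples of log n are 200 for releasing the children, 600 for
    -- consolidating them as roots, 200 for the second pass and 600 for the potential of the final
    -- roots: 1600 in all. The old roots are consolidated at the expense of the old potential.
    · simp only [pot, test_steps_not, test_steps_eq, steps_at, steps_var, steps_sentinel] at ht ⊢
      omega

end

/-! ### Counting loops -/

/-- An iteration adds 4 steps for the guard and 4 for the increment; the initialization (2) and the
last guard (4) give the 6. -/
theorem wp_forUpTo {x bound : WVar} {body : Prog} {σ : State} {N c : ℕ} (I : ℕ → State → Prop)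
    (hx : body.modW x = false) (hb : body.modW bound = false) (hne : bound ≠ x)
    (hN : σ.word bound = N) (h₀ : I 0 (σ.setW x 0))
    (h : ∀ i < N, ∀ τ, I i τ → τ.word x = i →
      wp body (fun τ' t => t ≤ c ∧ I (i + 1) (τ'.setW x (i + 1))) τ) :
    wp (forUpTo x bound body) (fun σ' t => I N σ' ∧ t ≤ N * (c + 8) + 6) σ := by
  simp only [forUpTo, wp_block_cons, wp_block_nil, wp_setW]
  refine (wp_loop (fun τ k => ∃ i ≤ N, I i τ ∧ τ.word x = i ∧ τ.word bound = N ∧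
    k = (N - i) * (c + 8)) ?_ (N * (c + 8)) _ ?_).mono ?_
  · rintro τ k ⟨i, hi, hI, hxi, hbN, rfl⟩ hlt
    simp only [holds_lt, eval_var, hxi, hbN] at hlt
    simp only [incr, wp_block_cons, wp_block_nil, wp_setW]
    refine (h i hlt τ hI hxi).frame ?_
    rintro τ' t hfr ⟨ht, hI'⟩
    have hxi' : τ'.word x = i := (hfr.word x hx).trans hxi
    refine ⟨_, ⟨i + 1, hlt, ?_, ?_, ?_, rfl⟩, ?_⟩
    · simpa [hxi'] using hI'
    · simp [hxi']
    · simp [hne, hfr.word bound hb, hbN]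
    · have : (N - i) * (c + 8) = (N - (i + 1)) * (c + 8) + (c + 8) := by
        rw [← Nat.succ_mul]; congr 1; omega
      simp only [test_steps_lt, steps_add, steps_var, steps_lit]
      omega
  · exact ⟨0, Nat.zero_le _, h₀, by simp, by simp [hne, hN], by simp⟩
  · rintro τ t ⟨k, ⟨i, hi, hI, hxi, hbN, rfl⟩, hlt, ht⟩
    simp only [holds_lt, eval_var, hxi, hbN] at hlt
    obtain rfl : i = N := by omega
    simp only [test_steps_lt, steps_lit, steps_var] at ht ⊢
    exact ⟨hI, by omega⟩

/-! ### Dijkstra's algorithm -/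

/-- The part of the input that Dijkstra's algorithm relies on: `off` is the array of offsets into
the array of the `m` heads of the edges. -/
structure Input (n m : ℕ) (off : ℕ → ℕ) (σ : State) : Prop where
  n_eq : σ.word .n = n
  s_lt : σ.word .s < n
  off_eq : ∀ v ≤ n, σ.warr .off v = off v
  head_lt : ∀ k < m, σ.warr .head k < n

theorem Input.frame {n m : ℕ} {off : ℕ → ℕ} {σ σ' : State} {p : Prog} (h : Input n m off σ)
    (hf : Frame p σ σ') (h₁ : p.modW .n = false) (h₂ : p.modW .s = false)
    (h₃ : p.modA .off = false) (h₄ : p.modA .head = false) : Input n m off σ' :=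
  ⟨hf.word .n h₁ ▸ h.n_eq, hf.word .s h₂ ▸ h.s_lt, hf.warr .off h₃ ▸ h.off_eq,
    hf.warr .head h₄ ▸ h.head_lt⟩

/-- The invariant of Dijkstra's algorithm: the items of the heap are the nodes with status 1. -/
structure DijkstraInv (n : ℕ) (A : Finset ℕ) (ch : ℕ → List ℕ) (σ : State) : Prop where
  heap : HeapInv n A ch n n σ
  min : MinOk n ch σ
  buckets : BucketsNull n σ
  status : ∀ v < n, v ∈ A ↔ σ.warr .status v = 1

/-- The nodes that have not been extracted from the heap. -/
def unsettled (n : ℕ) (σ : State) : Finset ℕ :=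
  (Finset.range n).filter fun v => σ.warr .status v ≠ 2

section
variable {n m : ℕ} {off : ℕ → ℕ} {σ : State} {A : Finset ℕ} {ch : ℕ → List ℕ}

/-- The loop over the edges that leave the node `u`. -/
theorem scanLoop_spec {u : ℕ} (hin : Input n m off σ) (hu : σ.word .u = u) (hun : u < n)
    (hm : off (u + 1) ≤ m) (hle : off u ≤ off (u + 1)) (he : σ.word .e = off u)
    (h : DijkstraInv n A ch σ) :
    wp (.loop (.lt .e (WArr.off.at (.u + .lit 1))) (block [
      .setW .v (WArr.head.at .e),
      .setR .c (RArr.key.at .u + RArr.cost.at .e),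
      .ite (.eq (WArr.status.at .v) (.lit 0))
        (block [
          .putW .status .v (.lit 1),
          .putW .pred .v .u,
          .putR .key .v .c,
          heapInsert])
        (.ite (.and (.eq (WArr.status.at .v) (.lit 1)) (.rlt .c (RArr.key.at .v)))
          (block [.putW .pred .v .u, heapDecreaseKey])
          .skip),
      incr .e])) (fun σ' t => ∃ A' ch', DijkstraInv n A' ch' σ' ∧
        unsettled n σ' = unsettled n σ ∧
        t + pot n A' ch' σ' ≤ 1700 * (off (u + 1) - off u) + 10 + pot n A ch σ) σ := by
  -- An edge causes at most one heap operation, the dearest being decrease-key with 1500. The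
  -- potential is part of the budget and so passes from edge to edge.
  refine (wp_loop (fun τ k => ∃ A' ch' i, Input n m off τ ∧ DijkstraInv n A' ch' τ ∧
    τ.word .u = u ∧ τ.word .e = i ∧ i ≤ off (u + 1) ∧ unsettled n τ = unsettled n σ ∧
    k = 1700 * (off (u + 1) - i) + pot n A' ch' τ) ?_ _ _
    ⟨A, ch, off u, hin, h, hu, he, hle, rfl, rfl⟩).mono ?_
  · rintro τ k ⟨A', ch', i, hin, hd, hu, hi, hile, hun', rfl⟩ hlt
    simp only [holds_lt, eval_at, eval_add, eval_var, eval_lit, hu, hi,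
      hin.off_eq (u + 1) hun] at hlt
    simp only [wp_block_cons, wp_block_nil, wp_setW, wp_setR]
    set τ₀ := (τ.setW .v ((WArr.head.at .e).eval τ)).setR .c
      ((RArr.key.at .u + RArr.cost.at .e).eval (τ.setW .v ((WArr.head.at .e).eval τ))) with hτ₀
    set v := τ.warr .head i with hv
    have hvn : v < n := hin.head_lt i (by omega)
    have hτv : τ₀.word .v = v := by simp [τ₀, hi, ← hv]
    have hτst : τ₀.warr .status = τ.warr .status := rfl
    have hi₀ : HeapInv n A' ch' n n τ₀ :=
      hd.heap.congr (by simp [τ₀]) rfl rfl rfl rfl rfl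
    have hmin₀ : MinOk n ch' τ₀ := by simpa [MinOk, τ₀] using hd.min
    have hpot₀ : pot n A' ch' τ₀ = pot n A' ch' τ := rfl
    -- Shared end of the three branches. Scanning neither creates nor removes status 2, so the
    -- unsettled nodes stay the same.
    have fin : ∀ (τ' : State) (A'' ch'' t), HeapInv n A'' ch'' n n τ' → MinOk n ch'' τ' →
        τ'.warr .bucket = τ.warr .bucket → (∀ w < n, w ∈ A'' ↔ τ'.warr .status w = 1) →
        (∀ w, τ'.warr .status w = 2 ↔ τ.warr .status w = 2) →
        τ'.word .n = τ.word .n → τ'.word .s = τ.word .s → τ'.word .u = τ.word .u →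
        τ'.word .e = τ.word .e → τ'.warr .off = τ.warr .off → τ'.warr .head = τ.warr .head →
        t + pot n A'' ch'' τ' ≤ 1690 + pot n A' ch' τ →
        ∃ k', (∃ A₁ ch₁ i₁, Input n m off (τ'.setW .e (((.e : WExpr) + .lit 1).eval τ')) ∧
          DijkstraInv n A₁ ch₁ (τ'.setW .e (((.e : WExpr) + .lit 1).eval τ')) ∧
          (τ'.setW .e (((.e : WExpr) + .lit 1).eval τ')).word .u = u ∧
          (τ'.setW .e (((.e : WExpr) + .lit 1).eval τ')).word .e = i₁ ∧ i₁ ≤ off (u + 1) ∧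
          unsettled n (τ'.setW .e (((.e : WExpr) + .lit 1).eval τ')) = unsettled n σ ∧
          k' = 1700 * (off (u + 1) - i₁) +
            pot n A₁ ch₁ (τ'.setW .e (((.e : WExpr) + .lit 1).eval τ'))) ∧
          t + 10 + k' ≤ 1700 * (off (u + 1) - i) + pot n A' ch' τ := by
      intro τ' A'' ch'' t h₁ h₂ h₃ h₄ h₅ h₆ h₇ h₈ h₉ h₁₀ h₁₁ h₁₂
      refine ⟨_, ⟨A'', ch'', i + 1, ⟨?_, ?_, ?_, ?_⟩, ⟨?_, ?_, ?_, ?_⟩, ?_, ?_, hlt, ?_, rfl⟩, ?_⟩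
      · simp [h₁.n_eq]
      · simpa [h₇] using hin.s_lt
      · simpa [h₁₀] using hin.off_eq
      · simpa [h₁₁] using hin.head_lt
      · exact h₁.congr (by simp) rfl rfl rfl rfl rfl
      · simpa [MinOk] using h₂
      · intro d hd'; simpa [h₃] using hd.buckets d hd'
      · exact h₄
      · simpa [h₈] using hu
      · simp [h₉, hi]
      · rw [← hun']
        refine Finset.filter_congr fun w _ => not_congr ?_
        simpa using h₅ w
      · have : pot n A'' ch'' (τ'.setW .e (((.e : WExpr) + .lit 1).eval τ')) =
          pot n A'' ch'' τ' := rfl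
        omega
    refine wp_ite (fun hs => ?_) (fun hs => wp_ite (fun hs₁ => ?_) (fun hs₁ => ?_))
    · simp only [holds_eq, eval_at, eval_var, eval_lit, hτv, hτst] at hs
      have hvA : v ∉ A' := by rw [hd.status v hvn]; omega
      simp only [wp_block_cons, wp_block_nil, wp_putW, wp_putR]
      set τ₁ := ((τ₀.putW .status ((WExpr.var .v).eval τ₀) ((WExpr.lit 1).eval τ₀)).putW .pred
        ((WExpr.var .v).eval (τ₀.putW .status ((WExpr.var .v).eval τ₀) ((WExpr.lit 1).eval τ₀)))
        ((WExpr.var .u).eval (τ₀.putW .status ((WExpr.var .v).eval τ₀)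
          ((WExpr.lit 1).eval τ₀)))) with hτ₁
      have hst₁ : τ₁.warr .status = update (τ.warr .status) v 1 := by simp [τ₁, hτv, hτst]
      refine wp.frame (p := heapInsert) (heapInsert_spec (n := n) (A := A') (ch := ch')
        (hi₀.congr ?_ ?_ ?_ ?_ ?_ ?_) ?_ ?_ ?_) ?_
      · simp [τ₁]
      · simp [τ₁]
      · simp [τ₁]
      · simp [τ₁]
      · simp [τ₁]
      · simp [τ₁]
      · simpa [τ₁, hτv] using hvn
      · simpa [τ₁, hτv] using hvA
      · simpa [τ₁, MinOk] using hmin₀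
      rintro τ₂ t hfr ⟨ch₂, hi₂, hmin₂, ht⟩
      rw [show ∀ a b, (τ₁.putR .key a b).word .v = v from fun a b => by simp [τ₁, hτv]] at hi₂ ht
      have hst₂ : τ₂.warr .status = update (τ.warr .status) v 1 :=
        (hfr.warr .status rfl).trans hst₁
      have hp₁ : ∀ a b, pot n A' ch' (τ₁.putR .key a b) = pot n A' ch' τ := by
        intro a b
        rw [pot, marked_congr (σ := τ) (by simp [τ₁, τ₀]) (by simp [τ₁, τ₀]), pot]
      rw [hp₁] at ht
      simp only [incr, wp_setW]
      have hstat₁ : ∀ w < n, w ∈ insert v A' ↔ τ₂.warr .status w = 1 := by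
        intro w hw
        rw [hst₂]
        by_cases e : w = v
        · subst e; simp
        · simp [e, hd.status w hw]
      have hstat₂ : ∀ w, τ₂.warr .status w = 2 ↔ τ.warr .status w = 2 := by
        intro w
        rw [hst₂]
        by_cases e : w = v
        · subst e; simp [hs]
        · simp [e]
      obtain ⟨k', hk₁, hk₂⟩ := fin τ₂ (insert v A') ch₂ (t + 100) hi₂ hmin₂
        ((hfr.warr .bucket rfl).trans (by simp [τ₁, τ₀])) hstat₁ hstat₂
        ((hfr.word .n rfl).trans (by simp [τ₁, τ₀])) ((hfr.word .s rfl).trans (by simp [τ₁, τ₀]))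
        ((hfr.word .u rfl).trans (by simp [τ₁, τ₀])) ((hfr.word .e rfl).trans (by simp [τ₁, τ₀]))
        ((hfr.warr .off rfl).trans (by simp [τ₁, τ₀]))
        ((hfr.warr .head rfl).trans (by simp [τ₁, τ₀])) (by omega)
      refine ⟨k', hk₁, le_trans ?_ hk₂⟩
      simp only [test_steps_lt, test_steps_eq, steps_at, steps_add, steps_var, steps_lit,
        rsteps_add, rsteps_at, rsteps_var]
      omega
    · simp only [holds_and, holds_eq, eval_at, eval_var, eval_lit, hτv, hτst] at hs₁
      have hvA : v ∈ A' := (hd.status v hvn).2 hs₁.1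
      simp only [wp_block_cons, wp_block_nil, wp_putW]
      refine wp.frame (p := heapDecreaseKey) (heapDecreaseKey_spec (n := n) (A := A') (ch := ch')
        (hi₀.congr ?_ ?_ ?_ ?_ ?_ ?_) ?_ ?_) ?_
      · simp
      · simp
      · simp
      · simp
      · simp
      · simp
      · simpa [hτv] using hvA
      · simpa [MinOk] using hmin₀
      rintro τ₂ t hfr ⟨ch₂, hi₂, hmin₂, ht⟩
      have hst₂ : τ₂.warr .status = τ.warr .status :=
        (hfr.warr .status rfl).trans (by simp [τ₀])
      have hp₁ : ∀ a b, pot n A' ch' (τ₀.putW .pred a b) = pot n A' ch' τ := by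
        intro a b
        rw [pot, marked_congr (σ := τ) (by simp [τ₀]) (by simp [τ₀]), pot]
      rw [hp₁] at ht
      simp only [incr, wp_setW]
      obtain ⟨k', hk₁, hk₂⟩ := fin τ₂ A' ch₂ (t + 100) hi₂ hmin₂
        ((hfr.warr .bucket rfl).trans (by simp [τ₀])) (by rw [hst₂]; exact hd.status)
        (by rw [hst₂]; exact fun _ => Iff.rfl)
        ((hfr.word .n rfl).trans (by simp [τ₀])) ((hfr.word .s rfl).trans (by simp [τ₀]))
        ((hfr.word .u rfl).trans (by simp [τ₀])) ((hfr.word .e rfl).trans (by simp [τ₀]))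
        ((hfr.warr .off rfl).trans (by simp [τ₀]))
        ((hfr.warr .head rfl).trans (by simp [τ₀])) (by omega)
      refine ⟨k', hk₁, le_trans ?_ hk₂⟩
      simp only [test_steps_lt, test_steps_eq, test_steps_and, test_steps_rlt, steps_at, steps_add,
        steps_var, steps_lit, rsteps_add, rsteps_at, rsteps_var]
      omega
    · simp only [wp_skip, incr, wp_setW]
      obtain ⟨k', hk₁, hk₂⟩ := fin τ₀ A' ch' 100 hi₀ hmin₀ rfl hd.status (fun _ => Iff.rfl)
        (by simp [τ₀]) (by simp [τ₀]) (by simp [τ₀]) (by simp [τ₀]) rfl rfl (by omega)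
      refine ⟨k', hk₁, le_trans ?_ hk₂⟩
      simp only [test_steps_lt, test_steps_eq, test_steps_and, test_steps_rlt, steps_at, steps_add,
        steps_var, steps_lit, rsteps_add, rsteps_at, rsteps_var]
      omega
  · rintro τ t ⟨k, ⟨A', ch', i, hin, hd, hu, hi, hile, hun', rfl⟩, hlt, ht⟩
    refine ⟨A', ch', hd, hun', ?_⟩
    simp only [test_steps_lt, steps_at, steps_add, steps_var, steps_lit] at ht
    omega

theorem heapInit_spec (hn : σ.word .n = n) :
    wp heapInit (fun σ' t => HeapInv n ∅ (fun _ => []) n n σ' ∧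
      MinOk n (fun _ => []) σ' ∧ BucketsNull n σ' ∧ t ≤ 20 * n + 20) σ := by
  simp only [heapInit, wp_block_cons, wp_block_nil]
  refine (wp_forUpTo (N := n) (c := 5)
    (fun i τ => τ.word .n = n ∧ ∀ d < i, τ.warr .bucket d = n) rfl rfl (by simp) hn ?_ ?_).mono ?_
  · simp [hn]
  · rintro i hi τ ⟨hτ, hb⟩ hv
    simp only [wp_putW]
    refine ⟨by simp, by simp [hτ], fun d hd => ?_⟩
    by_cases e : d = i
    · simp [hv, hτ, e]
    · simp [hv, hτ, e, hb d (by omega)]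
  · rintro τ t ⟨⟨hτ, hb⟩, ht⟩
    simp only [wp_putW, wp_setW]
    refine ⟨⟨by simp [hτ], ⟨⟨?_, ?_, ?_, ?_, ?_⟩, ?_, ?_⟩, ?_, ?_⟩, ?_, ?_, ?_⟩
    · simp
    · simp [Seg, cell, hτ]
    · simp
    · simp
    · simp
    · simp
    · simp
    · simp
    · simp
    · left; simp [hτ]
    · intro d hd; simp [hb d hd]
    · simp only [steps_null]; omega

theorem dijkstra_spec (hin : Input n m off σ) (hmono : ∀ v, off v ≤ off (v + 1))
    (hoff : off n ≤ m) :
    wp dijkstra (fun _ t => t ≤ 1600 * (n * Nat.log 2 n) + 2300 * n + 1700 * m + 1000) σ := by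
  -- The charge for settling `v`: an extraction, 200 for control, and 1700 per outgoing edge. The
  -- edge terms telescope to at most `m`.
  set cost : ℕ → ℕ := fun v => 1600 * Nat.log 2 n + 2200 + 1700 * (off (v + 1) - off v) with hcost
  have hoffm : Monotone off := monotone_nat_of_le_succ hmono
  have htotal : ∑ v ∈ Finset.range n, cost v ≤
      1600 * (n * Nat.log 2 n) + 2200 * n + 1700 * m := by
    simp only [hcost, Finset.sum_add_distrib, Finset.sum_const, Finset.card_range, smul_eq_mul,
      ← Finset.mul_sum, Finset.sum_range_tsub hoffm]
    have : n * (1600 * Nat.log 2 n) = 1600 * (n * Nat.log 2 n) := by ring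
    omega
  simp only [dijkstra, wp_block_cons, wp_block_nil]
  refine (wp_forUpTo (N := n) (c := 10)
    (fun i τ => τ.word .n = n ∧ ∀ v < i, τ.warr .status v = 0) rfl rfl (by simp) hin.n_eq
    ?_ ?_).frame ?_
  · simp [hin.n_eq]
  · rintro i hi τ ⟨hτ, hb⟩ hv
    simp only [wp_block_cons, wp_block_nil, wp_putW]
    refine ⟨by simp, by simp [hτ], fun d hd => ?_⟩
    by_cases e : d = i
    · simp [hv, e]
    · simp [hv, e, hb d (by omega)]
  rintro σ₁ t₁ hf₁ ⟨⟨hn₁, hst₁⟩, ht₁⟩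
  have hin₁ := hin.frame hf₁ rfl rfl rfl rfl
  refine (heapInit_spec hn₁).frame ?_
  rintro σ₂ t₂ hf₂ ⟨hi₂, hmin₂, hb₂, ht₂⟩
  have hin₂ := hin₁.frame hf₂ rfl rfl rfl rfl
  have hst₂ : ∀ v < n, σ₂.warr .status v = 0 := by rwa [hf₂.warr .status rfl]
  simp only [wp_setW, wp_putW, wp_putR]
  set s := σ₂.word .s with hs
  have hsn : s < n := hin₂.s_lt
  refine wp.frame (p := heapInsert) (heapInsert_spec (n := n) (A := ∅) (ch := fun _ => [])
    (hi₂.congr ?_ ?_ ?_ ?_ ?_ ?_) ?_ ?_ ?_) ?_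
  · simp
  · simp
  · simp
  · simp
  · simp
  · simp
  · simpa [← hs] using hsn
  · simp
  · simpa [MinOk] using hmin₂
  rintro σ₃ t₃ hf₃ ⟨ch₃, hi₃, hmin₃, ht₃⟩
  have hst₃ : σ₃.warr .status = update (σ₂.warr .status) s 1 :=
    (hf₃.warr .status rfl).trans (by simp [← hs])
  have hin₃ : Input n m off σ₃ := by
    refine ⟨hi₃.n_eq, ?_, ?_, ?_⟩
    · rw [hf₃.word .s rfl]; simpa [← hs] using hsn
    · rw [hf₃.warr .off rfl]; simpa using hin₂.off_eq
    · rw [hf₃.warr .head rfl]; simpa using hin₂.head_lt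
  have hd₃ : ∃ A₃, DijkstraInv n A₃ ch₃ σ₃ ∧ pot n A₃ ch₃ σ₃ + t₃ ≤ 500 := by
    refine ⟨_, ⟨hi₃, hmin₃, ?_, ?_⟩, ?_⟩
    · intro d hd
      rw [hf₃.warr .bucket rfl]; simpa using hb₂ d hd
    · intro v hv
      rw [hst₃]
      by_cases e : v = s
      · simp [e, ← hs]
      · simp [e, ← hs, hst₂ v hv]
    · simp only [pot, marked, Finset.filter_empty, Finset.card_empty, List.length_nil] at ht₃ ⊢
      omega
  obtain ⟨A₃, hd₃, hp₃⟩ := hd₃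
  clear ht₃
  -- An extracted node gets status 2 for good, so its charge is spent once.
  refine (wp_loop (fun τ k => ∃ A ch, Input n m off τ ∧ DijkstraInv n A ch τ ∧
    k = ∑ v ∈ unsettled n τ, cost v + pot n A ch τ) ?_ _ _ ⟨A₃, ch₃, hin₃, hd₃, rfl⟩).mono ?_
  · rintro τ k ⟨A, ch, hin, hd, rfl⟩ hne
    simp only [holds_not, holds_eq, eval_var, eval_null, hd.heap.n_eq] at hne
    simp only [wp_block_cons, wp_block_nil]
    refine (heapExtractMin_spec hd.heap hd.min hne hd.buckets).frame ?_
    rintro τ₁ t₁ hf₁ ⟨hu₁, huA, ch₁, hi₁, hmin₁, hb₁, ht₁⟩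
    set u := τ.word .min with hu
    have hun : u < n := hd.heap.forest.lt huA
    have hin₁ := hin.frame hf₁ rfl rfl rfl rfl
    have hsu : τ.warr .status u = 1 := (hd.status u hun).1 huA
    simp only [wp_putW, wp_setW]
    set τ₂ := (τ₁.putW .status ((WExpr.var .u).eval τ₁) ((WExpr.lit 2).eval τ₁)).setW .e
      ((WArr.off.at .u).eval (τ₁.putW .status ((WExpr.var .u).eval τ₁) ((WExpr.lit 2).eval τ₁)))
      with hτ₂
    have hst₂ : τ₂.warr .status = update (τ.warr .status) u 2 := by
      simp [τ₂, hu₁, hf₁.warr .status rfl]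
    have hin₂ : Input n m off τ₂ := by
      refine ⟨?_, ?_, ?_, ?_⟩
      · simpa [τ₂] using hin₁.n_eq
      · simpa [τ₂] using hin₁.s_lt
      · simpa [τ₂] using hin₁.off_eq
      · simpa [τ₂] using hin₁.head_lt
    have hd₂ : DijkstraInv n (A.erase u) ch₁ τ₂ := by
      refine ⟨hi₁.congr ?_ ?_ ?_ ?_ ?_ ?_, ?_, ?_, ?_⟩
      · simp [τ₂]
      · simp [τ₂]
      · simp [τ₂]
      · simp [τ₂]
      · simp [τ₂]
      · simp [τ₂]
      · simpa [MinOk, τ₂] using hmin₁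
      · intro d hd; simpa [τ₂] using hb₁ d hd
      · intro v hv
        rw [hst₂]
        by_cases e : v = u
        · simp [e]
        · simp [e, hd.status v hv]
    have hp₂ : pot n (A.erase u) ch₁ τ₂ = pot n (A.erase u) ch₁ τ₁ := by
      rw [pot, marked_congr (σ := τ₁) (by simp [τ₂]) (by simp [τ₂]), pot]
    have hsum : ∑ v ∈ unsettled n τ₂, cost v + cost u = ∑ v ∈ unsettled n τ, cost v := by
      have hmem : u ∈ unsettled n τ := by simp [unsettled, hun, hsu]
      rw [← Finset.sum_erase_add _ _ hmem]
      congr 2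
      ext v
      by_cases e : v = u
      · simp [unsettled, hst₂, e]
      · simp [unsettled, hst₂, e]
    refine (scanLoop_spec hin₂ (u := u) (by simpa [τ₂] using hu₁) hun
      ((hoffm (by omega : u + 1 ≤ n)).trans hoff) (hmono u)
      (by simp [τ₂, hu₁, hin₁.off_eq u hun.le]) hd₂).frame ?_
    rintro τ₃ t₃ hf₃ ⟨A', ch', hd₃, hun₃, ht₃⟩
    refine ⟨_, ⟨A', ch', hin₂.frame hf₃ rfl rfl rfl rfl, hd₃, rfl⟩, ?_⟩
    rw [hun₃, ← hsum]
    simp only [hcost, test_steps_not, test_steps_eq, steps_at, steps_var, steps_null, steps_lit]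
      at ht₃ ⊢
    omega
  · rintro τ t ⟨k, -, -, ht⟩
    have hle : ∑ v ∈ unsettled n σ₃, cost v ≤ ∑ v ∈ Finset.range n, cost v :=
      Finset.sum_le_sum_of_subset (Finset.filter_subset _ _)
    simp only [test_steps_not, test_steps_eq, steps_var, steps_null, steps_lit, rsteps_zero] at ht ⊢
    omega

end

/-! ### The Standard Algorithm -/

theorem computeCosts_spec {σ : State} {m W : ℕ} (hm : σ.word .m = m) (hW : σ.word .W = W) :
    wp computeCosts (fun _ t => t ≤ 30 * (m * W) + 30 * m + 20) σ := by
  simp only [computeCosts, wp_block_cons, wp_block_nil, wp_setW]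
  refine (wp_forUpTo (N := m) (c := W * 22 + 12) (fun _ τ => τ.word .W = W) rfl rfl (by simp)
    (by simpa using hm) (by simpa using hW) ?_).mono ?_
  · intro i _ τ hτ _
    simp only [wp_block_cons, wp_block_nil, wp_setR]
    refine (wp_forUpTo (N := W) (c := 14) (fun _ _ => True) rfl rfl (by simp)
      (by simpa using hτ) trivial ?_).frame ?_
    · intro j _ τ' _ _
      simp only [incr, wp_block_cons, wp_block_nil, wp_setR, wp_setW]
      simp
    · rintro τ' t hfr ⟨-, ht⟩
      simp only [wp_putR]
      refine ⟨?_, ?_⟩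
      · simp only [rsteps_zero, steps_var, rsteps_var]; omega
      · simpa [hfr.word .W rfl] using hτ
  · rintro τ t ⟨-, ht⟩
    have : m * (W * 22 + 12 + 8) = 22 * (m * W) + 20 * m := by ring
    simp only [steps_lit]
    omega

theorem standardAlgorithm_spec {n m W K : ℕ} {off : ℕ → ℕ} {σ : State} (hin : Input n m off σ)
    (hmono : ∀ v, off v ≤ off (v + 1)) (hoff : off n ≤ m)
    (hm : σ.word .m = m) (hW : σ.word .W = W) (hK : σ.word .K = K) :
    wp standardAlgorithm (fun _ t => t ≤
      K * (1600 * (n * Nat.log 2 n) + 2400 * n + 30 * (m * W) + 1800 * m + 2000) + 100) σ := by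
  simp only [standardAlgorithm, wp_block_cons, wp_block_nil, wp_setW]
  refine (wp_forUpTo (N := K)
    (c := 1600 * (n * Nat.log 2 n) + 2400 * n + 30 * (m * W) + 1800 * m + 1500)
    (fun _ τ => Input n m off τ ∧ τ.word .m = m ∧ τ.word .W = W) rfl rfl (by simp)
    (by simpa using hK) ?_ ?_).mono ?_
  · refine ⟨⟨?_, ?_, hin.off_eq, hin.head_lt⟩, ?_, ?_⟩
    · simpa using hin.n_eq
    · simpa using hin.s_lt
    · simpa using hm
    · simpa using hW
  · rintro i _ τ ⟨hin, hm, hW⟩ _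
    simp only [wp_block_cons, wp_block_nil]
    refine (computeCosts_spec hm hW).frame ?_
    intro τ₁ t₁ hf₁ ht₁
    have hin₁ := hin.frame hf₁ rfl rfl rfl rfl
    refine (dijkstra_spec hin₁ hmono hoff).frame ?_
    intro τ₂ t₂ hf₂ ht₂
    have hin₂ := hin₁.frame hf₂ rfl rfl rfl rfl
    refine (wp_forUpTo (N := n) (c := 10) (fun _ _ => True) rfl rfl (by simp) hin₂.n_eq trivial
      ?_).frame ?_
    · intro j _ τ' _ _
      simp only [incr, wp_block_cons, wp_block_nil, wp_putW, wp_setW]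
      simp
    · rintro τ₃ t₃ hf₃ ⟨-, ht₃⟩
      have hin₃ := hin₂.frame hf₃ rfl rfl rfl rfl
      simp only [wp_setW]
      refine ⟨?_, ⟨?_, ?_, hin₃.off_eq, hin₃.head_lt⟩, ?_, ?_⟩
      · simp only [steps_add, steps_var]; omega
      · simpa using hin₃.n_eq
      · simpa using hin₃.s_lt
      · simpa [hf₃.word .m rfl, hf₂.word .m rfl, hf₁.word .m rfl] using hm
      · simpa [hf₃.word .W rfl, hf₂.word .W rfl, hf₁.word .W rfl] using hW
  · rintro τ t ⟨-, ht⟩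
    simp only [steps_lit]
    have : K * (1600 * (n * Nat.log 2 n) + 2400 * n + 30 * (m * W) + 1800 * m + 1500 + 8) ≤
      K * (1600 * (n * Nat.log 2 n) + 2400 * n + 30 * (m * W) + 1800 * m + 2000) :=
      Nat.mul_le_mul_left _ (by omega)
    omega

/-- The edge numbering is onto the indices below |E|, so each stored head is the head of an actual
edge and hence a node. -/
theorem Loaded.input {n W K : ℕ} {G : MOG n W} {s : Fin n} {Λ : Fin K → CoeffVector W}
    {σ : State} (h : Loaded G s Λ σ) :
    Input n G.E.card (fun v => (G.E.filter fun e => (e.1 : ℕ) < v).card) σ := by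
  refine ⟨h.n_eq, h.s_eq ▸ s.isLt, h.off_eq, fun k hk => ?_⟩
  obtain ⟨edge, hedge⟩ := h.edges
  have := (hedge ⟨k, hk⟩).2.2.1
  simp only at this
  rw [this]
  exact (edge ⟨k, hk⟩).1.2.isLt

end MOWSP

/-! ### The asymptotic bound. -/

theorem lemmal0 :
    ∃ C : ℝ, ∀ (n W K : ℕ), 2 ≤ n → 1 ≤ W → 1 ≤ K →
      ∀ (G : MOWSP.MOG n W) (s : Fin n) (Λ : Fin K → MOWSP.CoeffVector W) (σ : MOWSP.State),
        MOWSP.Loaded G s Λ σ →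
          ∃ (σ' : MOWSP.State) (t : ℕ), MOWSP.Exec MOWSP.standardAlgorithm σ σ' t ∧
            (t : ℝ) ≤ C * ((K : ℝ) * W * G.E.card + (K : ℝ) * n * Real.log n) := by
  refine ⟨20000, fun n W K hn hW hK G s Λ σ h => ?_⟩
  obtain ⟨σ', t, he, ht⟩ := MOWSP.standardAlgorithm_spec h.input
    (fun v => Finset.card_le_card (Finset.monotone_filter_right _ fun e _ he => Nat.lt_succ_of_lt he))
    (Finset.card_filter_le _ _) h.m_eq h.W_eq h.K_eq
  refine ⟨σ', t, he, ?_⟩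
  set m := G.E.card
  set L := Nat.log 2 n with hL
  have hL1 : 1 ≤ L := Nat.log_pos (by norm_num) hn
  have hnL : n ≤ n * L := Nat.le_mul_of_pos_right n hL1
  have hmW : m ≤ m * W := Nat.le_mul_of_pos_right m hW
  -- As n ≥ 2 and L ≥ 1, both n and the constant 2000 are absorbed by multiples of nL; W ≥ 1 absorbs
  -- m into mW.
  have h₁ : 1600 * (n * L) + 2400 * n + 30 * (m * W) + 1800 * m + 2000 ≤
      9000 * (m * W + n * L) := by omega
  have h₂ : K * (1600 * (n * L) + 2400 * n + 30 * (m * W) + 1800 * m + 2000) ≤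
      K * (9000 * (m * W + n * L)) := Nat.mul_le_mul_left K h₁
  have h₃ : m * W + n * L ≤ K * (m * W + n * L) := Nat.le_mul_of_pos_left _ hK
  have h₄ : t ≤ 10000 * (K * (m * W + n * L)) := by
    have : K * (9000 * (m * W + n * L)) = 9000 * (K * (m * W + n * L)) := by ring
    omega
  -- Since ln 2 > 1/2, passing from the binary to the natural logarithm at most doubles the
  -- constant, from 10000 to 20000.
  have h₅ : (L : ℝ) ≤ 2 * Real.log n := by
    have h := Real.natLog_le_logb n 2
    have hl := Real.log_two_gt_d9
    have hlog : 0 ≤ Real.log n := Real.log_natCast_nonneg n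
    rw [Real.logb] at h
    refine h.trans ?_
    rw [div_le_iff₀ (by positivity)]
    push_cast
    nlinarith
  have h₆ : (t : ℝ) ≤ 10000 * (K * (m * W + n * L)) := by exact_mod_cast h₄
  refine h₆.trans ?_
  have h₇ : (K : ℝ) * n * L ≤ K * n * (2 * Real.log n) := by gcongr
  have h₈ : (0 : ℝ) ≤ K * W * m := by positivity
  nlinarith
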